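/- Graphs are multigraphs: loops and parallel edges are allowed (and the graph may be infinite). A cycle is the edge set of a closed path $v_0,e_0,v_1,\dots,v_n,e_n,v_0$ with $n\ge 0$, distinct vertices and distinct edges, so a loop is a cycle of length one. Subgraphs below are identified with their edge sets. A \emph{theta} consists of three internally disjoint paths between two distinct vertices; it contains exactly three cycles. A set $\mathcal B$ of cycles of $G$ has the \emph{theta property} if no theta of $G$ contains exactly two cycles in $\mathcal B$; then $(G,\mathcal B)$ is a \emph{biased graph}, and cycles in $\mathcal B$ are \emph{balanced}, all others \emph{unbalanced}. \emph{Tight handcuffs} are two edge-disjoint cycles having exactly one vertex in common; \emph{loose handcuffs} are two vertex-disjoint cycles together with a minimal path linking them (it meets each cycle in exactly one vertex, an end of the path); in a biased graph both cycles of handcuffs are required to be unbalanced. A \emph{bracelet} of $(G,\mathcal B)$ is the union of two vertex-disjoint unbalanced cycles. The \emph{cyclomatic number} of a set $X$ of edges is the minimum number of edges whose removal from $X$ leaves no cycle. The \emph{bracelet graph} of $(G,\mathcal B)$ has the bracelets as its vertices, distinct bracelets $B,B'$ being adjacent if and only if $B\cup B'$ has cyclomatic number $3$. A \emph{bracelet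 function} is a map $\chi$ from the set of bracelets to $\{\mathsf{independent},\mathsf{dependent}\}$; it is \emph{proper} if $\chi(B_1)=\chi(B_2)$ whenever $B_1$ and $B_2$ are in the same component of the bracelet graph. \textbf{Theorem.} (1) Let $(G,\mathcal B)$ be a biased graph and let $\chi$ be a proper bracelet function for $(G,\mathcal B)$. Let $\mathcal C(G,\mathcal B,\chi)$ be the collection of edge sets of: balanced cycles; thetas with no cycle in $\mathcal B$; tight handcuffs (both cycles unbalanced); bracelets $B$ with $\chi(B)=\mathsf{dependent}$; and loose handcuffs whose two cycles are unbalanced and form a bracelet $B$ with $\chi(B)=\mathsf{independent}$. Then $\mathcal C(G,\mathcal B,\chi)$ is the set of circuits of a matroid on $E(G)$. (2) Let $(\mathcal B,\mathcal L,\mathcal F)$ be a proper tripartition of the cycles of a graph $G$, that is, a partition of the set of all cycles of $G$ into three (possibly empty) sets such that $\mathcal B$ has the theta property and every cycle in $\mathcal L$ has a vertex in common with every cycle in $\mathcal F$. Let $\mathcal C(G,\mathcal B,\mathcal L,\mathcal F)$ be the collection of edge sets of: cycles in $\mathcal B$; thetas with no cycle in $\mathcal B$; tight handcuffs with neither cycle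 in $\mathcal B$; unions of two vertex-disjoint cycles both in $\mathcal L$; and loose handcuffs with both cycles in $\mathcal F$. Then $\mathcal C(G,\mathcal B,\mathcal L,\mathcal F)$ is the set of circuits of a matroid on $E(G)$. -/

import Mathlib

/-!
Graphs are multigraphs, with loops and parallel edges allowed (Mathlib's `Graph`).
Cycles, paths, thetas, handcuffs and bracelets are given by their edge sets.
-/

namespace Graph

variable {V E : Type*}

/-- The set of vertices incident to an edge of `X`, i.e. the vertex set of the subgraph `G[X]`
induced by the set of edges `X`. -/
def vertsOf (G : Graph V E) (X : Set E) : Set V := {x | ∃ e ∈ X, G.Inc e x}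

/-- `C` is the edge set of a cycle `v 0, e 0, v 1, e 1, ..., v n, e n, v 0` of length `n + 1`
(the addition `i + 1` in `Fin (n + 1)` is cyclic). A loop is a cycle of length one, a pair of
parallel edges forms a cycle of length two. -/
def IsCycle (G : Graph V E) (C : Set E) : Prop :=
  ∃ (n : ℕ) (v : Fin (n + 1) → V) (e : Fin (n + 1) → E),
    Function.Injective v ∧ Function.Injective e ∧
    (∀ i, G.IsLink (e i) (v i) (v (i + 1))) ∧ C = Set.range e

/-- `P` is the edge set of a path from `x` to `y`
(the vertices of a path are pairwise distinct). -/
def IsPath (G : Graph V E) (x y : V) (P : Set E) : Prop :=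
  ∃ (n : ℕ) (v : Fin (n + 1) → V) (e : Fin n → E),
    Function.Injective v ∧ (∀ i, v i ∈ G.vertexSet) ∧
    (∀ i : Fin n, G.IsLink (e i) (v i.castSucc) (v i.succ)) ∧
    v 0 = x ∧ v (Fin.last n) = y ∧ P = Set.range e

/-- `P`, `Q`, `R` are the edge sets of three internally disjoint paths with the same two
distinct ends. Then `P ∪ Q ∪ R` is a theta, and its three cycles are `P ∪ Q`, `P ∪ R`, `Q ∪ R`.
(Disjointness of the edge sets says that two of the paths are not the same single edge.) -/
def IsTheta (G : Graph V E) (P Q R : Set E) : Prop :=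
  ∃ x y : V, x ≠ y ∧ G.IsPath x y P ∧ G.IsPath x y Q ∧ G.IsPath x y R ∧
    Disjoint P Q ∧ Disjoint P R ∧ Disjoint Q R ∧
    G.vertsOf P ∩ G.vertsOf Q = {x, y} ∧
    G.vertsOf P ∩ G.vertsOf R = {x, y} ∧
    G.vertsOf Q ∩ G.vertsOf R = {x, y}

/-- `C` and `C'` are two edge-disjoint cycles that meet in exactly one vertex. -/
def IsTightHandcuffs (G : Graph V E) (C C' : Set E) : Prop :=
  G.IsCycle C ∧ G.IsCycle C' ∧ Disjoint C C' ∧ ∃ x, G.vertsOf C ∩ G.vertsOf C' = {x}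

/-- `C` and `C'` are two vertex-disjoint cycles, and `P` is a minimal path linking them: it meets
each of the two cycles in one of its ends only. -/
def IsLooseHandcuffs (G : Graph V E) (C C' P : Set E) : Prop :=
  G.IsCycle C ∧ G.IsCycle C' ∧ Disjoint (G.vertsOf C) (G.vertsOf C') ∧
    ∃ x y, G.IsPath x y P ∧ G.vertsOf P ∩ G.vertsOf C = {x} ∧ G.vertsOf P ∩ G.vertsOf C' = {y}

/-- The theta property: no theta has exactly two of its three cycles in `𝓑`. (The three paths of
a theta may be permuted, so this covers every pair of its cycles.) -/
def ThetaProperty (G : Graph V E) (𝓑 : Set (Set E)) : Prop :=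
  ∀ P Q R, G.IsTheta P Q R → P ∪ Q ∈ 𝓑 → P ∪ R ∈ 𝓑 → Q ∪ R ∈ 𝓑

/-- `(G, 𝓑)` is a biased graph: `𝓑` is a set of cycles of `G` with the theta property. -/
structure IsBiased (G : Graph V E) (𝓑 : Set (Set E)) : Prop where
  isCycle : ∀ C ∈ 𝓑, G.IsCycle C
  theta : G.ThetaProperty 𝓑

/-- `B` is (the edge set of) a bracelet of `(G, 𝓑)`: a pair of vertex-disjoint unbalanced
cycles. -/
def IsBracelet (G : Graph V E) (𝓑 : Set (Set E)) (B : Set E) : Prop :=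
  ∃ C C', G.IsCycle C ∧ G.IsCycle C' ∧ C ∉ 𝓑 ∧ C' ∉ 𝓑 ∧
    Disjoint (G.vertsOf C) (G.vertsOf C') ∧ B = C ∪ C'

/-- The type of bracelets of `(G, 𝓑)`. -/
abbrev Bracelet (G : Graph V E) (𝓑 : Set (Set E)) : Type _ := {B : Set E // G.IsBracelet 𝓑 B}

/-- The cyclomatic number of a set `X` of edges: the minimum number of edges whose removal
from `X` leaves no cycle. -/
noncomputable def cyclomaticNumber (G : Graph V E) (X : Set E) : ℕ∞ :=
  sInf {k : ℕ∞ | ∃ F ⊆ X, F.encard = k ∧ ∀ C, G.IsCycle C → ¬ C ⊆ X \ F}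

/-- The bracelet graph of `(G, 𝓑)`: distinct bracelets `B`, `B'` are adjacent if and only if
the cyclomatic number of `B ∪ B'` is three. -/
def braceletGraph (G : Graph V E) (𝓑 : Set (Set E)) : SimpleGraph (G.Bracelet 𝓑) where
  Adj B B' := B ≠ B' ∧ G.cyclomaticNumber (B.1 ∪ B'.1) = 3
  symm := ⟨fun _ _ h => ⟨h.1.symm, by rw [Set.union_comm]; exact h.2⟩⟩
  loopless := ⟨fun _ h => h.1 rfl⟩

/-- The two values of a bracelet function. -/
inductive BraceletValue
  | independent
  | dependent

/-- A bracelet function `χ` is proper if it is constant on the components of the bracelet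
graph. -/
def IsProperBraceletFunction (G : Graph V E) (𝓑 : Set (Set E))
    (χ : G.Bracelet 𝓑 → BraceletValue) : Prop :=
  ∀ B B', (G.braceletGraph 𝓑).Reachable B B' → χ B = χ B'

/-- The collection `𝓒(G, 𝓑, χ)`: balanced cycles; thetas with no balanced cycle; tight handcuffs
(with both cycles unbalanced); bracelets `B` with `χ B = dependent`; loose handcuffs whose
bracelet `B` has `χ B = independent`. -/
def braceletCircuits (G : Graph V E) (𝓑 : Set (Set E)) (χ : G.Bracelet 𝓑 → BraceletValue) :
    Set (Set E) :=
  {X | X ∈ 𝓑 ∨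
    (∃ P Q R, G.IsTheta P Q R ∧ P ∪ Q ∉ 𝓑 ∧ P ∪ R ∉ 𝓑 ∧ Q ∪ R ∉ 𝓑 ∧ X = P ∪ Q ∪ R) ∨
    (∃ C C', G.IsTightHandcuffs C C' ∧ C ∉ 𝓑 ∧ C' ∉ 𝓑 ∧ X = C ∪ C') ∨
    (∃ B : G.Bracelet 𝓑, χ B = BraceletValue.dependent ∧ X = B.1) ∨
    (∃ (B : G.Bracelet 𝓑) (C C' P : Set E), χ B = BraceletValue.independent ∧
      G.IsLooseHandcuffs C C' P ∧ C ∉ 𝓑 ∧ C' ∉ 𝓑 ∧ B.1 = C ∪ C' ∧ X = C ∪ C' ∪ P)}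

/-- `(𝓑, 𝓛, 𝓕)` is a proper tripartition of the cycles of `G`: a partition into three (possibly
empty) sets such that `𝓑` has the theta property and every cycle in `𝓛` meets every cycle in
`𝓕`, i.e. has a vertex in common with it. -/
structure IsProperTripartition (G : Graph V E) (𝓑 𝓛 𝓕 : Set (Set E)) : Prop where
  union_eq : 𝓑 ∪ 𝓛 ∪ 𝓕 = {C | G.IsCycle C}
  disjoint_BL : Disjoint 𝓑 𝓛
  disjoint_BF : Disjoint 𝓑 𝓕
  disjoint_LF : Disjoint 𝓛 𝓕
  theta : G.ThetaProperty 𝓑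
  meets : ∀ C ∈ 𝓛, ∀ C' ∈ 𝓕, (G.vertsOf C ∩ G.vertsOf C').Nonempty

/-- The collection `𝓒(G, 𝓑, 𝓛, 𝓕)`: cycles in `𝓑`; thetas with no cycle in `𝓑`; tight handcuffs
with neither cycle in `𝓑`; pairs of vertex-disjoint cycles both in `𝓛`; loose handcuffs with both
cycles in `𝓕`. -/
def tripartitionCircuits (G : Graph V E) (𝓑 𝓛 𝓕 : Set (Set E)) : Set (Set E) :=
  {X | X ∈ 𝓑 ∨
    (∃ P Q R, G.IsTheta P Q R ∧ P ∪ Q ∉ 𝓑 ∧ P ∪ R ∉ 𝓑 ∧ Q ∪ R ∉ 𝓑 ∧ X = P ∪ Q ∪ R) ∨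
    (∃ C C', G.IsTightHandcuffs C C' ∧ C ∉ 𝓑 ∧ C' ∉ 𝓑 ∧ X = C ∪ C') ∨
    (∃ C C', C ∈ 𝓛 ∧ C' ∈ 𝓛 ∧ Disjoint (G.vertsOf C) (G.vertsOf C') ∧ X = C ∪ C') ∨
    (∃ C C' P, G.IsLooseHandcuffs C C' P ∧ C ∈ 𝓕 ∧ C' ∈ 𝓕 ∧ X = C ∪ C' ∪ P)}

/-- `𝓒` is the set of circuits of a matroid with ground set `E(G)`. -/
def IsCircuitSetOfMatroid (G : Graph V E) (𝓒 : Set (Set E)) : Prop :=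
  ∃ M : Matroid E, M.E = G.edgeSet ∧ {X | M.IsCircuit X} = 𝓒

end Graph

/-! Both parts are instances of one statement about a biased graph with a symmetric relation `Dep`
on cycles, saying which pairs of vertex-disjoint unbalanced cycles are themselves circuits; the
other disjoint pairs become circuits only together with a linking path. The single requirement
(`IsProperRel`) is that, for unbalanced cycles, `Dep C F` passes to `Dep D F` when `F` is disjoint
from both `C` and `D`.

A set of edges contains no circuit exactly when all its cycles are unbalanced, each component has at
most one cycle, and no two of its cycles are dependent (`pairIndep_iff`). For a finite such set,
edges plus acyclic components add up to the number of vertices (`SeparatesCycles.exists_isRootSet`).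
Circuits are finite, so independence is finitary even when the graph is infinite, and augmentation
is needed only for finite sets.

Augmentation (`PairIndep.exists_insert`): let `I` be smaller than `J`, both independent, and suppose
no edge of `J` extends `I`. No edge of `J` leaves an acyclic component of `I`, and `I` has more
acyclic components than `J`, so one of them contains a cycle of `J`. The theta property yields an
edge of that cycle closing an unbalanced cycle `C` with `I` (`exists_unbalanced_insert`). This edge
can be blocked only by a cycle `C₁` of `I` with `Dep C C₁`, and properness then makes `C₁` the only
cycle of `I`. Now no edge of `J` joins different components of `I`, and counting again gives two
disjoint cycles of `J`. Exchanging cycles one at a time, starting from `C` and `C₁`, shows that they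
are dependent, which contradicts the independence of `J`.

For bracelet functions, properness of the relation says that two bracelets with a common cycle `F`
lie in one component of the bracelet graph (`BraceletDep.congr`); the first cycle is rerouted
through thetas towards the second. For tripartitions, `Dep` means that both cycles are in `𝓛`, and
properness is immediate because an unbalanced cycle disjoint from a member of `𝓛` cannot be in `𝓕`.
-/

namespace Graph

open Set

variable {V E : Type*} {G : Graph V E} {x y z a b r : V} {e f : E}
  {S T X Y P Q R C C' D D' F I J : Set E} {𝓑 𝓛 𝓕 : Set (Set E)}
  {Dep : Set E → Set E → Prop}

/-! ### Connection by a set of edges -/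

/-- `G.Conn S a b`: the vertices `a` and `b` are joined by a walk with edges in `S`. -/
def Conn (G : Graph V E) (S : Set E) : V → V → Prop :=
  Relation.ReflTransGen fun a b => ∃ e ∈ S, G.IsLink e a b

lemma Conn.refl (G : Graph V E) (S : Set E) (a : V) : G.Conn S a a := Relation.ReflTransGen.refl

lemma Conn.trans (h : G.Conn S a b) (h' : G.Conn S b x) : G.Conn S a x :=
  Relation.ReflTransGen.trans h h'

lemma Conn.of_isLink (h : G.IsLink e a b) (he : e ∈ S) : G.Conn S a b :=
  Relation.ReflTransGen.single ⟨e, he, h⟩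

lemma Conn.symm (h : G.Conn S a b) : G.Conn S b a := by
  induction h with
  | refl => exact Conn.refl _ _ _
  | tail _ h ih =>
    obtain ⟨e, he, h⟩ := h
    exact (Conn.of_isLink h.symm he).trans ih

lemma Conn.mono (h : G.Conn S a b) (hST : S ⊆ T) : G.Conn T a b :=
  Relation.ReflTransGen.mono (fun _ _ ⟨e, he, h⟩ => ⟨e, hST he, h⟩) _ _ h

/-- Crossing `e` more than once never helps: on a later crossing, the walk so far can be replaced by
a walk in `S` to an end of `e`, followed by at most one crossing. -/
lemma Conn.of_insert (he : G.IsLink e x y) (h : G.Conn (insert e S) a b) :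
    G.Conn S a b ∨ (G.Conn S a x ∧ G.Conn S y b) ∨ (G.Conn S a y ∧ G.Conn S x b) := by
  induction h with
  | refl => exact Or.inl (Conn.refl _ _ _)
  | tail _ h ih =>
    obtain ⟨f, rfl | hf, h⟩ := h
    · rcases h.eq_and_eq_or_eq_and_eq he with ⟨rfl, rfl⟩ | ⟨rfl, rfl⟩
      · rcases ih with ih | ⟨ih, -⟩ | ⟨ih, -⟩
        · exact Or.inr (Or.inl ⟨ih, Conn.refl _ _ _⟩)
        · exact Or.inr (Or.inl ⟨ih, Conn.refl _ _ _⟩)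
        · exact Or.inl ih
      · rcases ih with ih | ⟨ih, -⟩ | ⟨ih, -⟩
        · exact Or.inr (Or.inr ⟨ih, Conn.refl _ _ _⟩)
        · exact Or.inl ih
        · exact Or.inr (Or.inr ⟨ih, Conn.refl _ _ _⟩)
    · have := Conn.of_isLink h hf
      rcases ih with ih | ⟨ih, ih'⟩ | ⟨ih, ih'⟩
      · exact Or.inl (ih.trans this)
      · exact Or.inr (Or.inl ⟨ih, ih'.trans this⟩)
      · exact Or.inr (Or.inr ⟨ih, ih'.trans this⟩)

lemma Conn.of_insert_of_conn (h : G.Conn (insert e S) a b) (he : G.IsLink e x y)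
    (hxy : G.Conn S x y) : G.Conn S a b := by
  rcases h.of_insert he with h | ⟨h, h'⟩ | ⟨h, h'⟩
  · exact h
  · exact h.trans (hxy.trans h')
  · exact h.trans (hxy.symm.trans h')

/-- If no edge of `T` leaves the `S`-component of `x`, then this component contains the
`T`-component of `x`. -/
lemma Conn.of_closed (h : G.Conn T x y)
    (hcl : ∀ e ∈ T, ∀ a b, G.IsLink e a b → G.Conn S x a → G.Conn S x b) : G.Conn S x y := by
  induction h with
  | refl => exact Conn.refl _ _ _
  | tail _ h ih =>
    obtain ⟨e, he, h⟩ := h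
    exact hcl e he _ _ h ih

/-! ### Vertex sets of sets of edges -/

lemma vertsOf_mono (h : X ⊆ Y) : G.vertsOf X ⊆ G.vertsOf Y := fun _ ⟨e, he, h'⟩ => ⟨e, h he, h'⟩

lemma vertsOf_union (X Y : Set E) : G.vertsOf (X ∪ Y) = G.vertsOf X ∪ G.vertsOf Y := by
  ext x
  constructor
  · rintro ⟨e, he | he, h⟩
    · exact Or.inl ⟨e, he, h⟩
    · exact Or.inr ⟨e, he, h⟩
  · rintro (⟨e, he, h⟩ | ⟨e, he, h⟩)
    · exact ⟨e, Or.inl he, h⟩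
    · exact ⟨e, Or.inr he, h⟩

lemma vertsOf_singleton (h : G.IsLink e x y) : G.vertsOf {e} = {x, y} := by
  ext z
  constructor
  · rintro ⟨_, rfl, h'⟩
    exact h'.eq_or_eq_of_isLink h
  · rintro (rfl | rfl)
    · exact ⟨e, rfl, h.inc_left⟩
    · exact ⟨e, rfl, h.inc_right⟩

lemma vertsOf_finite (hX : X.Finite) : (G.vertsOf X).Finite := by
  have : G.vertsOf X = ⋃ e ∈ X, {x | G.Inc e x} := by
    ext x; simp [vertsOf]
  rw [this]
  refine hX.biUnion fun e _ => ?_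
  by_cases he : e ∈ G.edgeSet
  · obtain ⟨a, b, h⟩ := exists_isLink_of_mem_edgeSet he
    refine (Set.toFinite {a, b}).subset fun x hx => ?_
    exact Inc.eq_or_eq_of_isLink hx h
  · convert Set.finite_empty
    ext x
    simp [not_inc_of_notMem_edgeSet he]

/-! ### Walks indexed by natural numbers -/

/-- `v 0, e 0, v 1, ..., e (n - 1), v n` is a walk. -/
def IsWalk (G : Graph V E) (v : ℕ → V) (e : ℕ → E) (n : ℕ) : Prop :=
  ∀ i < n, G.IsLink (e i) (v i) (v (i + 1))

section Walk

variable {v : ℕ → V} {w : ℕ → E} {n : ℕ}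

lemma IsWalk.eq_or_eq (h : G.IsWalk v w n) {i : ℕ} (hi : i < n) (ha : G.Inc (w i) a) :
    a = v i ∨ a = v (i + 1) := ha.eq_or_eq_of_isLink (h i hi)

lemma IsWalk.vertsOf_image (h : G.IsWalk v w n) (hn : 0 < n) :
    G.vertsOf (w '' Iio n) = v '' Iic n := by
  ext a
  constructor
  · rintro ⟨_, ⟨i, hi, rfl⟩, ha⟩
    rcases h.eq_or_eq hi ha with rfl | rfl
    · exact ⟨i, mem_Iic.2 (le_of_lt hi), rfl⟩
    · exact ⟨i + 1, mem_Iic.2 (Nat.succ_le_of_lt hi), rfl⟩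
  · rintro ⟨i, hi, rfl⟩
    rcases (mem_Iic.1 hi).lt_or_eq with hi | rfl
    · exact ⟨w i, ⟨i, hi, rfl⟩, (h i hi).inc_left⟩
    · refine ⟨w (i - 1), ⟨i - 1, by simp; omega, rfl⟩, ?_⟩
      have := (h (i - 1) (by omega)).inc_right
      rwa [Nat.sub_add_cancel hn] at this

lemma IsWalk.injOn_edge (h : G.IsWalk v w n) (hv : InjOn v (Iic n)) : InjOn w (Iio n) := by
  intro i hi j hj hij
  simp only [mem_Iio] at hi hj
  have h1 := h i hi
  rw [hij] at h1
  rcases h1.eq_and_eq_or_eq_and_eq (h j hj) with ⟨h1, -⟩ | ⟨h1, h2⟩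
  · exact hv (mem_Iic.2 hi.le) (mem_Iic.2 hj.le) h1
  · have e1 := hv (mem_Iic.2 hi.le) (mem_Iic.2 hj) h1
    have e2 := hv (mem_Iic.2 hi) (mem_Iic.2 hj.le) h2
    omega

lemma IsWalk.conn (h : G.IsWalk v w n) {i j : ℕ} (hij : i ≤ j) (hj : j ≤ n) :
    G.Conn (w '' Ico i j) (v i) (v j) := by
  induction j, hij using Nat.le_induction with
  | base => exact Conn.refl _ _ _
  | succ k hk ih =>
    refine ((ih (by omega)).mono (image_mono (Ico_subset_Ico_right (Nat.le_succ k)))).trans ?_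
    exact Conn.of_isLink (h k (by omega)) ⟨k, ⟨hk, Nat.lt_succ_self k⟩, rfl⟩

lemma IsWalk.isPath (h : G.IsWalk v w n) (hn : 0 < n) (hv : InjOn v (Iic n)) :
    G.IsPath (v 0) (v n) (w '' Iio n) := by
  refine ⟨n, fun i => v i, fun i => w i, ?_, ?_, fun i => ?_, rfl, rfl, ?_⟩
  · intro i j hij
    exact Fin.ext (hv (mem_Iic.2 (by omega)) (mem_Iic.2 (by omega)) hij)
  · intro i
    rcases Nat.lt_or_ge i n with hi | hi
    · exact (h i hi).left_mem
    · have := (h (n - 1) (by omega)).right_mem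
      rw [Nat.sub_add_cancel hn] at this
      have hi' : (i : ℕ) = n := by omega
      simpa [hi'] using this
  · simpa using h i i.2
  · ext f
    constructor
    · rintro ⟨i, hi, rfl⟩
      exact ⟨⟨i, hi⟩, rfl⟩
    · rintro ⟨i, rfl⟩
      exact ⟨i, i.2, rfl⟩

lemma IsWalk.isCycle (h : G.IsWalk v w n) (hn : 0 < n) (hv : InjOn v (Iio n))
    (hw : InjOn w (Iio n)) (h0 : v n = v 0) : G.IsCycle (w '' Iio n) := by
  obtain ⟨m, rfl⟩ := Nat.exists_eq_succ_of_ne_zero hn.ne'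
  refine ⟨m, fun i => v i, fun i => w i, ?_, ?_, fun i => ?_, ?_⟩
  · intro i j hij
    exact Fin.ext (hv (mem_Iio.2 i.2) (mem_Iio.2 j.2) hij)
  · intro i j hij
    exact Fin.ext (hw (mem_Iio.2 i.2) (mem_Iio.2 j.2) hij)
  · have := h i i.2
    rcases eq_or_ne i (Fin.last m) with rfl | hi
    · simpa [h0] using this
    · have hi' : ((i + 1 : Fin (m + 1)) : ℕ) = i + 1 := Fin.val_add_one_of_lt (Fin.lt_last_iff_ne_last.2 hi)
      simpa [hi'] using this
  · ext f
    constructor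
    · rintro ⟨i, hi, rfl⟩
      exact ⟨⟨i, hi⟩, rfl⟩
    · rintro ⟨i, rfl⟩
      exact ⟨i, i.2, rfl⟩

end Walk

/-- Indexing by `ℕ` turns splitting, reversing and concatenating into arithmetic. The ends must
differ so that the path has an edge, which serves as the default value beyond its length. -/
lemma IsPath.exists_isWalk (h : G.IsPath x y P) (hxy : x ≠ y) :
    ∃ (n : ℕ) (v : ℕ → V) (w : ℕ → E), 0 < n ∧ G.IsWalk v w n ∧ InjOn v (Iic n) ∧
      v 0 = x ∧ v n = y ∧ P = w '' Iio n := by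
  obtain ⟨n, v, e, hv, -, hl, rfl, rfl, rfl⟩ := h
  have hn : 0 < n := by
    rcases Nat.eq_zero_or_pos n with rfl | hn
    · exact absurd rfl hxy
    · exact hn
  have hval : ∀ i (hi : i ≤ n), Fin.ofNat (n + 1) i = ⟨i, Nat.lt_succ_of_le hi⟩ := fun i hi =>
    Fin.ext (by simp [Fin.ofNat, Nat.mod_eq_of_lt (Nat.lt_succ_of_le hi)])
  refine ⟨n, fun i => v (Fin.ofNat (n + 1) i),
    fun i => if hi : i < n then e ⟨i, hi⟩ else e ⟨0, hn⟩, hn, ?_, ?_, ?_, ?_, ?_⟩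
  · intro i hi
    simp only [hi, dif_pos, hval i hi.le, hval (i + 1) hi]
    exact hl ⟨i, hi⟩
  · intro i hi j hj hij
    have := hv hij
    rw [hval i hi, hval j hj] at this
    simpa using this
  · simp only [hval 0 (Nat.zero_le n)]; rfl
  · simp only [hval n le_rfl]; rfl
  · ext f
    constructor
    · rintro ⟨i, rfl⟩
      exact ⟨i, i.2, by simp⟩
    · rintro ⟨i, hi, rfl⟩
      exact ⟨⟨i, hi⟩, by simp [mem_Iio.1 hi]⟩

lemma IsCycle.exists_isWalk (h : G.IsCycle C) (hx : x ∈ G.vertsOf C) :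
    ∃ (n : ℕ) (v : ℕ → V) (w : ℕ → E), 0 < n ∧ G.IsWalk v w n ∧ InjOn v (Iio n) ∧
      InjOn w (Iio n) ∧ v n = x ∧ v 0 = x ∧ C = w '' Iio n := by
  obtain ⟨n, v, e, hv, he, hl, rfl⟩ := h
  obtain ⟨k, rfl⟩ : ∃ k, v k = x := by
    obtain ⟨_, ⟨i, rfl⟩, hi⟩ := hx
    rcases hi.eq_or_eq_of_isLink (hl i) with rfl | rfl
    exacts [⟨_, rfl⟩, ⟨_, rfl⟩]
  have hsucc : ∀ i, Fin.ofNat (n + 1) (i + 1) = Fin.ofNat (n + 1) i + 1 := fun i =>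
    Fin.ext (by simp [Fin.ofNat, Fin.val_add])
  have hinj : ∀ i < n + 1, ∀ j < n + 1,
      Fin.ofNat (n + 1) i + k = Fin.ofNat (n + 1) j + k → i = j := by
    intro i hi j hj hij
    have := congrArg Fin.val (add_right_cancel hij)
    simpa [Fin.ofNat, Nat.mod_eq_of_lt hi, Nat.mod_eq_of_lt hj] using this
  have h0 : Fin.ofNat (n + 1) 0 = 0 := rfl
  have hn : Fin.ofNat (n + 1) (n + 1) = 0 := Fin.ext (by simp [Fin.ofNat])
  -- Shifting the cyclic index by `k` makes the walk start and end at `x`. The vertex `x` occurs at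
  -- both ends, hence injectivity only below the length.
  refine ⟨n + 1, fun i => v (Fin.ofNat (n + 1) i + k), fun i => e (Fin.ofNat (n + 1) i + k),
    Nat.succ_pos n, ?_, ?_, ?_, ?_, ?_, ?_⟩
  · intro i hi
    have := hl (Fin.ofNat (n + 1) i + k)
    rwa [add_right_comm, ← hsucc] at this
  · exact fun i hi j hj hij => hinj i hi j hj (hv hij)
  · exact fun i hi j hj hij => hinj i hi j hj (he hij)
  · simp only [hn, zero_add]
  · simp only [h0, zero_add]
  · ext f
    constructor
    · rintro ⟨i, rfl⟩
      refine ⟨(i - k).val, (i - k).2, ?_⟩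
      have : Fin.ofNat (n + 1) (i - k).val = i - k :=
        Fin.ext (by simp [Fin.ofNat, Nat.mod_eq_of_lt (i - k).2])
      simp only [this, sub_add_cancel]
    · rintro ⟨i, hi, rfl⟩
      exact ⟨_, rfl⟩

lemma Conn.exists_isWalk [Nonempty E] (h : G.Conn S x y) :
    ∃ (n : ℕ) (v : ℕ → V) (w : ℕ → E), G.IsWalk v w n ∧ (∀ i < n, w i ∈ S) ∧ v 0 = x ∧ v n = y := by
  induction h using Relation.ReflTransGen.head_induction_on with
  | refl => exact ⟨0, fun _ => y, fun _ => Classical.arbitrary E, fun i hi => absurd hi (by omega),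
      fun i hi => absurd hi (by omega), rfl, rfl⟩
  | @head a _ h _ ih =>
    obtain ⟨e, he, h⟩ := h
    obtain ⟨n, v, w, hw, hS, rfl, rfl⟩ := ih
    refine ⟨n + 1, fun i => Nat.casesOn i a v, fun i => Nat.casesOn i e w, ?_, ?_, rfl, rfl⟩
    · rintro (_ | i) hi
      · exact h
      · exact hw i (by omega)
    · rintro (_ | i) hi
      · exact he
      · exact hS i (by omega)

/-- A shortest walk with edges in `S` among those whose ends satisfy an irreflexive relation. -/
lemma Conn.exists_shortest_isWalk (r : V → V → Prop) (hr : ∀ a, ¬ r a a)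
    (h : G.Conn S x y) (hxy : r x y) :
    ∃ (n : ℕ) (v : ℕ → V) (w : ℕ → E), 0 < n ∧ G.IsWalk v w n ∧ (∀ i < n, w i ∈ S) ∧
      r (v 0) (v n) ∧ InjOn v (Iic n) ∧
      ∀ i j, i < j → j ≤ n → r (v i) (v j) → i = 0 ∧ j = n := by
  classical
  have hE : Nonempty E := by
    rcases Relation.ReflTransGen.cases_head h with rfl | ⟨_, ⟨e, -⟩, -⟩
    · exact absurd hxy (hr _)
    · exact ⟨e⟩
  have hex : ∃ (n : ℕ) (v : ℕ → V) (w : ℕ → E), G.IsWalk v w n ∧ (∀ i < n, w i ∈ S) ∧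
      r (v 0) (v n) := by
    obtain ⟨n, v, w, h1, h2, rfl, rfl⟩ := h.exists_isWalk
    exact ⟨n, v, w, h1, h2, hxy⟩
  obtain ⟨v, w, hw, hS, hvr⟩ := Nat.find_spec hex
  have hmin : ∀ m, m < Nat.find hex → ∀ (v : ℕ → V) (w : ℕ → E), G.IsWalk v w m →
      (∀ i < m, w i ∈ S) → ¬ r (v 0) (v m) :=
    fun m hm v w h1 h2 h3 => Nat.find_min hex hm ⟨v, w, h1, h2, h3⟩
  generalize Nat.find hex = n at *
  have hinj : ∀ i j, i < j → j ≤ n → v i ≠ v j := by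
    intro i j hij hj heq
    -- Cutting out the closed piece between two visits to the same vertex leaves a shorter walk with
    -- the same ends.
    refine hmin (n - (j - i)) (by omega) (fun k => if k ≤ i then v k else v (k + (j - i)))
      (fun k => if k < i then w k else w (k + (j - i))) ?_ ?_ ?_
    · intro k hk
      rcases lt_trichotomy k i with hki | rfl | hki
      · simp only [hki, hki.le, Nat.succ_le_of_lt hki, if_true]
        exact hw k (by omega)
      · have := hw (k + (j - k)) (by omega)
        have e1 : k + (j - k) = j := by omega
        simp only [le_rfl, if_true, lt_irrefl, if_false, Nat.not_succ_le_self]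
        rw [show k + 1 + (j - k) = k + (j - k) + 1 by omega, heq]
        rwa [e1] at this ⊢
      · have := hw (k + (j - i)) (by omega)
        simp only [not_lt_of_gt hki, not_le_of_gt hki, if_false, show ¬ k + 1 ≤ i by omega]
        rwa [show k + 1 + (j - i) = k + (j - i) + 1 by omega]
    · intro k hk
      split_ifs
      · exact hS k (by omega)
      · exact hS _ (by omega)
    · simp only [Nat.zero_le, if_true]
      split_ifs with hk
      · have : n = j := by omega
        subst this
        rwa [show n - (n - i) = i by omega, heq]
      · rwa [show n - (j - i) + (j - i) = n by omega]
  refine ⟨n, v, w, ?_, hw, hS, hvr, ?_, ?_⟩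
  · rcases Nat.eq_zero_or_pos n with rfl | hn
    · exact absurd hvr (hr _)
    · exact hn
  · intro i hi j hj hij
    rcases lt_trichotomy i j with h | h | h
    · exact absurd hij (hinj i j h hj)
    · exact h
    · exact absurd hij.symm (hinj j i h hi)
  · intro i j hij hj hrij
    by_contra hne
    refine hmin (j - i) (by omega) (fun k => v (k + i)) (fun k => w (k + i)) ?_ ?_ ?_
    · intro k hk
      have := hw (k + i) (by omega)
      rwa [show k + i + 1 = k + 1 + i by omega] at this
    · exact fun k hk => hS _ (by omega)
    · simpa [show j - i + i = j by omega] using hrij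

/-! ### Paths and cycles -/

lemma IsCycle.finite (h : G.IsCycle C) : C.Finite := by
  obtain ⟨n, v, e, -, -, -, rfl⟩ := h
  exact finite_range e

lemma IsCycle.nonempty (h : G.IsCycle C) : C.Nonempty := by
  obtain ⟨n, v, e, -, -, -, rfl⟩ := h
  exact ⟨e 0, 0, rfl⟩

lemma IsCycle.subset_edgeSet (h : G.IsCycle C) : C ⊆ G.edgeSet := by
  obtain ⟨n, v, e, -, -, hl, rfl⟩ := h
  rintro _ ⟨i, rfl⟩
  exact (hl i).edge_mem

lemma IsPath.finite (h : G.IsPath x y P) : P.Finite := by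
  obtain ⟨n, v, e, -, -, -, -, -, rfl⟩ := h
  exact finite_range e

lemma IsPath.subset_edgeSet (h : G.IsPath x y P) : P ⊆ G.edgeSet := by
  obtain ⟨n, v, e, -, -, hl, -, -, rfl⟩ := h
  rintro _ ⟨i, rfl⟩
  exact (hl i).edge_mem

lemma vertsOf_nonempty (hX : X ⊆ G.edgeSet) (h : X.Nonempty) : (G.vertsOf X).Nonempty := by
  obtain ⟨e, he⟩ := h
  obtain ⟨a, b, h⟩ := exists_isLink_of_mem_edgeSet (hX he)
  exact ⟨a, e, he, h.inc_left⟩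

lemma IsCycle.vertsOf_nonempty (h : G.IsCycle C) : (G.vertsOf C).Nonempty :=
  Graph.vertsOf_nonempty h.subset_edgeSet h.nonempty

lemma IsPath.nonempty (h : G.IsPath x y P) (hxy : x ≠ y) : P.Nonempty := by
  obtain ⟨n, v, w, hn, -, -, -, -, rfl⟩ := h.exists_isWalk hxy
  exact ⟨w 0, 0, hn, rfl⟩

lemma IsPath.conn (h : G.IsPath x y P) (hxy : x ≠ y) : G.Conn P x y := by
  obtain ⟨n, v, w, hn, hw, -, rfl, rfl, rfl⟩ := h.exists_isWalk hxy
  refine (hw.conn (Nat.zero_le n) le_rfl).mono ?_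
  rintro _ ⟨i, hi, rfl⟩
  exact ⟨i, hi.2, rfl⟩

lemma IsPath.conn_of_mem (h : G.IsPath x y P) (hxy : x ≠ y) (ha : a ∈ G.vertsOf P) :
    G.Conn P x a := by
  obtain ⟨n, v, w, hn, hw, -, rfl, rfl, rfl⟩ := h.exists_isWalk hxy
  rw [hw.vertsOf_image hn] at ha
  obtain ⟨i, hi, rfl⟩ := ha
  refine (hw.conn (Nat.zero_le i) hi).mono ?_
  rintro _ ⟨j, hj, rfl⟩
  exact ⟨j, mem_Iio.2 (lt_of_lt_of_le hj.2 hi), rfl⟩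

lemma IsPath.inc_unique_left (h : G.IsPath x y P) (hxy : x ≠ y) :
    ∃ e ∈ P, ∃ z, z ≠ x ∧ G.IsLink e z x ∧ ∀ f ∈ P, G.Inc f x → f = e := by
  obtain ⟨n, v, w, hn, hw, hv, rfl, rfl, rfl⟩ := h.exists_isWalk hxy
  refine ⟨w 0, ⟨0, hn, rfl⟩, v 1, ?_, (hw 0 hn).symm, ?_⟩
  · intro h
    have := hv (mem_Iic.2 hn) (mem_Iic.2 hn.le) h
    omega
  · rintro _ ⟨i, hi, rfl⟩ hinc
    rw [mem_Iio] at hi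
    rcases hw.eq_or_eq hi hinc with h | h
    · rw [hv (mem_Iic.2 hn.le) (mem_Iic.2 hi.le) h]
    · have := hv (mem_Iic.2 hn.le) (mem_Iic.2 hi) h
      omega

/-- Two distinct vertices of a cycle split it into two internally disjoint paths. -/
lemma IsCycle.exists_split (h : G.IsCycle C) (hx : x ∈ G.vertsOf C) (hy : y ∈ G.vertsOf C)
    (hxy : x ≠ y) : ∃ Q R, G.IsPath x y Q ∧ G.IsPath x y R ∧ Disjoint Q R ∧ Q ∪ R = C ∧
      G.vertsOf Q ∩ G.vertsOf R = {x, y} := by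
  obtain ⟨n, v, w, hn, hw, hv, he, hvn, rfl, rfl⟩ := h.exists_isWalk hx
  rw [hw.vertsOf_image hn] at hy
  obtain ⟨k, hk, rfl⟩ := hy
  have hk0 : 0 < k := Nat.pos_of_ne_zero fun h => hxy (by rw [h])
  have hkn : k < n := lt_of_le_of_ne hk fun h => hxy (by rw [h, hvn])
  have hQ : G.IsWalk v w k := fun i hi => hw i (hi.trans hkn)
  -- The second path runs backwards along the cycle, from `v n = x` down to `v k = y`.
  have hR : G.IsWalk (fun i => v (n - i)) (fun i => w (n - 1 - i)) (n - k) := by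
    intro i hi
    have := (hw (n - 1 - i) (by omega)).symm
    rwa [show n - 1 - i + 1 = n - i by omega,
      show v (n - 1 - i) = v (n - (i + 1)) by congr 1; omega] at this
  have hRi : InjOn (fun i => v (n - i)) (Iic (n - k)) := by
    intro i hi j hj hij
    simp only [mem_Iic] at hi hj
    rcases Nat.eq_zero_or_pos i with rfl | hi0 <;> rcases Nat.eq_zero_or_pos j with rfl | hj0
    · rfl
    · simp only [Nat.sub_zero, hvn] at hij
      have := hv (mem_Iio.2 hn) (mem_Iio.2 (by omega)) hij
      omega
    · simp only [Nat.sub_zero, hvn] at hij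
      have := hv (mem_Iio.2 (by omega)) (mem_Iio.2 hn) hij
      omega
    · have := hv (mem_Iio.2 (by omega)) (mem_Iio.2 (by omega)) hij
      omega
  have hQP := hQ.isPath hk0 (hv.mono fun i hi => mem_Iio.2 (lt_of_le_of_lt hi hkn))
  have hRP := hR.isPath (by omega) hRi
  simp only [Nat.sub_zero, hvn, show n - (n - k) = k by omega] at hRP
  have hRim : (fun i => w (n - 1 - i)) '' Iio (n - k) = w '' Ico k n := by
    ext f
    constructor
    · rintro ⟨i, hi, rfl⟩
      rw [mem_Iio] at hi
      exact ⟨n - 1 - i, ⟨by omega, by omega⟩, rfl⟩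
    · rintro ⟨i, hi, rfl⟩
      obtain ⟨h1, h2⟩ := hi
      exact ⟨n - 1 - i, mem_Iio.2 (by omega), by simp only [show n - 1 - (n - 1 - i) = i by omega]⟩
  refine ⟨_, _, hQP, hRP, ?_, ?_, ?_⟩
  · rw [hRim, Set.disjoint_left]
    rintro _ ⟨i, hi, rfl⟩ ⟨j, ⟨hj1, hj2⟩, hij⟩
    have := he (mem_Iio.2 hj2) (mem_Iio.2 (lt_trans hi hkn)) hij
    rw [mem_Iio] at hi
    omega
  · rw [hRim, ← image_union, Iio_union_Ico_eq_Iio hkn.le]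
  · rw [hQ.vertsOf_image hk0, hR.vertsOf_image (by omega)]
    apply subset_antisymm
    · rintro _ ⟨⟨i, hi, rfl⟩, ⟨j, hj, hij⟩⟩
      simp only [mem_Iic] at hi hj
      dsimp only at hij
      rcases Nat.eq_zero_or_pos j with rfl | hj0
      · left
        rw [← hij, Nat.sub_zero, hvn]
      · have := hv (mem_Iio.2 (by omega)) (mem_Iio.2 (by omega)) hij
        right
        rw [mem_singleton_iff]
        congr 1
        omega
    · rintro _ (rfl | rfl)
      · exact ⟨⟨0, mem_Iic.2 hk0.le, rfl⟩, ⟨0, mem_Iic.2 (Nat.zero_le _), by simp [hvn]⟩⟩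
      · exact ⟨⟨k, mem_Iic.2 le_rfl, rfl⟩, ⟨n - k, mem_Iic.2 le_rfl,
          by simp only [show n - (n - k) = k by omega]⟩⟩

/-- The union of two internally disjoint paths with the same distinct ends is a cycle. -/
lemma IsPath.union_isCycle (hP : G.IsPath x y P) (hQ : G.IsPath x y Q) (hxy : x ≠ y)
    (hPQ : Disjoint P Q) (hV : G.vertsOf P ∩ G.vertsOf Q ⊆ {x, y}) : G.IsCycle (P ∪ Q) := by
  obtain ⟨n, v, w, hn, hw, hv, rfl, rfl, rfl⟩ := hP.exists_isWalk hxy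
  obtain ⟨m, v', w', hm, hw', hv', h0, hmn, rfl⟩ := hQ.exists_isWalk hxy
  rw [hw.vertsOf_image hn, hw'.vertsOf_image hm] at hV
  have hcross : ∀ i ≤ n, ∀ j, 0 < j → j < m → v i ≠ v' j := by
    intro i hi j hj hjm hij
    rcases hV ⟨⟨i, hi, rfl⟩, ⟨j, mem_Iic.2 hjm.le, hij.symm⟩⟩ with h | h
    · rw [hij, ← h0] at h
      have := hv' (mem_Iic.2 hjm.le) (mem_Iic.2 (Nat.zero_le _)) h
      omega
    · rw [mem_singleton_iff, hij, ← hmn] at h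
      have := hv' (mem_Iic.2 hjm.le) (mem_Iic.2 le_rfl) h
      omega
  have hwalk : G.IsWalk (fun i => if i ≤ n then v i else v' (n + m - i))
      (fun i => if i < n then w i else w' (n + m - 1 - i)) (n + m) := by
    intro i hi
    rcases lt_or_ge i n with hin | hin
    · simp only [hin, hin.le, Nat.succ_le_of_lt hin, if_true]
      exact hw i hin
    · have := (hw' (n + m - 1 - i) (by omega)).symm
      rw [show n + m - 1 - i + 1 = n + m - i by omega,
        show v' (n + m - 1 - i) = v' (n + m - (i + 1)) by congr 1; omega] at this
      simp only [not_lt_of_ge hin, if_false, show ¬ i + 1 ≤ n by omega]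
      split_ifs with h
      · have hi : i = n := by omega
        subst hi
        rwa [show i + m - i = m by omega, hmn] at this
      · exact this
  have hc := hwalk.isCycle (by omega) ?_ ?_ ?_
  · convert hc using 1
    ext f
    constructor
    · rintro (⟨i, hi, rfl⟩ | ⟨i, hi, rfl⟩)
      · rw [mem_Iio] at hi
        exact ⟨i, mem_Iio.2 (by omega), by simp [hi]⟩
      · rw [mem_Iio] at hi
        refine ⟨n + m - 1 - i, mem_Iio.2 (by omega), ?_⟩
        simp only [show ¬ n + m - 1 - i < n by omega, if_false]
        congr 1
        omega
    · rintro ⟨i, hi, rfl⟩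
      rw [mem_Iio] at hi
      dsimp only
      split_ifs with h
      · exact Or.inl ⟨i, h, rfl⟩
      · exact Or.inr ⟨_, mem_Iio.2 (by omega), rfl⟩
  · intro i hi j hj hij
    rw [mem_Iio] at hi hj
    dsimp only at hij
    split_ifs at hij with h1 h2 h2
    · exact hv h1 h2 hij
    · exact absurd hij (hcross i h1 _ (by omega) (by omega))
    · exact absurd hij.symm (hcross j h2 _ (by omega) (by omega))
    · have := hv' (mem_Iic.2 (by omega)) (mem_Iic.2 (by omega)) hij
      omega
  · intro i hi j hj hij
    rw [mem_Iio] at hi hj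
    dsimp only at hij
    split_ifs at hij with h1 h2 h2
    · exact hw.injOn_edge hv h1 h2 hij
    · exact absurd ⟨_, mem_Iio.2 (by omega), hij.symm⟩ (Set.disjoint_left.1 hPQ ⟨i, h1, rfl⟩)
    · exact absurd ⟨_, mem_Iio.2 (by omega), hij⟩ (Set.disjoint_left.1 hPQ ⟨j, h2, rfl⟩)
    · have := hw'.injOn_edge hv' (mem_Iio.2 (by omega)) (mem_Iio.2 (by omega)) hij
      omega
  · simp [show ¬ n + m ≤ n by omega, h0]

lemma isCycle_singleton (h : G.IsLink e x x) : G.IsCycle {e} := by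
  refine ⟨0, fun _ => x, fun _ => e, ?_, ?_, fun _ => h, by simp⟩ <;>
  · intro i j _
    omega

/-! ### Connection and cycles -/

lemma IsCycle.conn (h : G.IsCycle C) (hx : x ∈ G.vertsOf C) (hy : y ∈ G.vertsOf C) :
    G.Conn C x y := by
  rcases eq_or_ne x y with rfl | hxy
  · exact Conn.refl _ _ _
  · obtain ⟨Q, R, hQ, -, -, rfl, -⟩ := h.exists_split hx hy hxy
    exact (hQ.conn hxy).mono subset_union_left

lemma IsCycle.conn_diff (h : G.IsCycle C) (he : e ∈ C) (hl : G.IsLink e x y) :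
    G.Conn (C \ {e}) x y := by
  rcases eq_or_ne x y with rfl | hxy
  · exact Conn.refl _ _ _
  · obtain ⟨Q, R, hQ, hR, hQR, rfl, -⟩ := h.exists_split ⟨e, he, hl.inc_left⟩
      ⟨e, he, hl.inc_right⟩ hxy
    rcases he with he | he
    · exact (hR.conn hxy).mono fun f hf =>
        ⟨Or.inr hf, fun h => Set.disjoint_left.1 hQR he (by rwa [← mem_singleton_iff.1 h])⟩
    · exact (hQ.conn hxy).mono fun f hf =>
        ⟨Or.inl hf, fun h => Set.disjoint_right.1 hQR he (by rwa [← mem_singleton_iff.1 h])⟩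

lemma Conn.exists_isPath (h : G.Conn S x y) (hxy : x ≠ y) : ∃ P ⊆ S, G.IsPath x y P := by
  obtain ⟨n, v, w, hn, hw, hS, ⟨rfl, rfl⟩, hv, -⟩ :=
    h.exists_shortest_isWalk (fun a b => a = x ∧ b = y) (fun a h => hxy (h.1.symm.trans h.2))
      ⟨rfl, rfl⟩
  exact ⟨_, image_subset_iff.2 hS, hw.isPath hn hv⟩

/-- An edge whose ends are joined by other edges closes a cycle. -/
lemma Conn.exists_isCycle (h : G.Conn S x y) (hl : G.IsLink e x y) (he : e ∉ S) :
    ∃ C, G.IsCycle C ∧ e ∈ C ∧ C ⊆ insert e S := by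
  rcases eq_or_ne x y with rfl | hxy
  · exact ⟨{e}, isCycle_singleton hl, rfl, by simp⟩
  · obtain ⟨P, hPS, hP⟩ := h.exists_isPath hxy
    have he' : G.IsPath x y {e} := by
      refine ⟨1, fun i => if i = 0 then x else y, fun _ => e, ?_, ?_, ?_, ?_, ?_, ?_⟩
      · intro i j
        fin_cases i <;> fin_cases j <;> simp [hxy, hxy.symm]
      · intro i
        fin_cases i <;> simp [hl.left_mem, hl.right_mem]
      · intro i
        fin_cases i
        simpa using hl
      · simp
      · simp
      · simp
    refine ⟨{e} ∪ P, he'.union_isCycle hP hxy ?_ ?_, Or.inl rfl, ?_⟩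
    · simpa using fun h => he (hPS h)
    · rw [vertsOf_singleton hl]
      exact inter_subset_left
    · rw [singleton_union]
      exact insert_subset_insert hPS

lemma IsCycle.exists_inc_ne (h : G.IsCycle C) (he : e ∈ C) (hl : G.IsLink e x y) (hxy : x ≠ y) :
    ∃ f ∈ C, f ≠ e ∧ G.Inc f y := by
  rcases Relation.ReflTransGen.cases_head (h.conn_diff he hl.symm) with h | ⟨_, ⟨f, hf, hl'⟩, -⟩
  · exact absurd h.symm hxy
  · exact ⟨f, hf.1, hf.2, hl'.inc_left⟩

/-- A cycle contains every walk that it meets in an edge, if at each interior vertex of the walk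
it can only use edges of the walk. -/
lemma IsWalk.image_subset_of_isCycle {v : ℕ → V} {w : ℕ → E} {n : ℕ} (h : G.IsWalk v w n)
    (hD : G.IsCycle D) (hne : 1 < n → ∀ i < n, v i ≠ v (i + 1))
    (hint : ∀ i, i + 1 < n → ∀ f ∈ D, G.Inc f (v (i + 1)) → f = w i ∨ f = w (i + 1))
    {i : ℕ} (hi : i < n) (hiD : w i ∈ D) : w '' Iio n ⊆ D := by
  -- From an edge of the walk in `D`, the second edge of `D` at the next vertex must be the next
  -- edge of the walk; `hdown` is the same in the other direction. The guard `1 < n` in `hne` admits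
  -- a single loop, where nothing needs propagating.
  have hup : ∀ j, i ≤ j → j < n → w j ∈ D := by
    intro j hij
    induction j, hij using Nat.le_induction with
    | base => exact fun _ => hiD
    | succ j hij ih =>
      intro hj
      obtain ⟨f, hf, hfe, hfi⟩ := hD.exists_inc_ne (ih (by omega)) (h j (by omega))
        (hne (by omega) j (by omega))
      rcases hint j hj f hf hfi with rfl | rfl
      · exact absurd rfl hfe
      · exact hf
  have hdown : ∀ k, k ≤ i → w (i - k) ∈ D := by
    intro k
    induction k with
    | zero => exact fun _ => hiD
    | succ k ih =>
      intro hk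
      have hl := h (i - k) (by omega)
      obtain ⟨f, hf, hfe, hfi⟩ := hD.exists_inc_ne (ih (by omega)) hl.symm
        (hne (by omega) _ (by omega)).symm
      have e1 : i - k = i - (k + 1) + 1 := by omega
      rw [e1] at hfi hfe
      rcases hint _ (by omega) f hf hfi with rfl | rfl
      · exact hf
      · exact absurd rfl hfe
  rintro _ ⟨j, hj, rfl⟩
  rcases le_total i j with hij | hij
  · exact hup j hij hj
  · have := hdown (i - j) (by omega)
    rwa [show i - (i - j) = j by omega] at this

lemma IsPath.subset_of_isCycle (h : G.IsPath x y P) (hxy : x ≠ y) (hD : G.IsCycle D)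
    (hint : ∀ a ∈ G.vertsOf P, a ≠ x → a ≠ y → ∀ f ∈ D, G.Inc f a → f ∈ P)
    (heP : e ∈ P) (heD : e ∈ D) : P ⊆ D := by
  obtain ⟨n, v, w, hn, hw, hv, rfl, rfl, rfl⟩ := h.exists_isWalk hxy
  obtain ⟨i, hi, rfl⟩ := heP
  refine hw.image_subset_of_isCycle hD ?_ ?_ hi heD
  · intro _ i hi h
    have := hv (mem_Iic.2 hi.le) (mem_Iic.2 hi) h
    omega
  · intro i hi f hf hinc
    obtain ⟨j, hj, rfl⟩ := hint (v (i + 1)) (by rw [hw.vertsOf_image hn]; exact ⟨_, hi.le, rfl⟩)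
      (fun h => by have := hv (mem_Iic.2 hi.le) (mem_Iic.2 hn.le) h; omega)
      (fun h => by have := hv (mem_Iic.2 hi.le) (mem_Iic.2 le_rfl) h; omega) f hf hinc
    rw [mem_Iio] at hj
    rcases hw.eq_or_eq hj hinc with h | h
    · right
      rw [hv (mem_Iic.2 hi.le) (mem_Iic.2 hj.le) h]
    · left
      have := hv (mem_Iic.2 hi.le) (mem_Iic.2 hj) h
      congr 1
      omega

lemma IsCycle.subset_of_isCycle (h : G.IsCycle C) (hx : x ∈ G.vertsOf C) (hD : G.IsCycle D)
    (hint : ∀ a ∈ G.vertsOf C, a ≠ x → ∀ f ∈ D, G.Inc f a → f ∈ C)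
    (heC : e ∈ C) (heD : e ∈ D) : C ⊆ D := by
  obtain ⟨n, v, w, hn, hw, hv, -, hvn, rfl, rfl⟩ := h.exists_isWalk hx
  obtain ⟨i, hi, rfl⟩ := heC
  refine hw.image_subset_of_isCycle hD ?_ ?_ hi heD
  · intro hn1 i hi h
    rcases Nat.lt_or_ge (i + 1) n with hi1 | hi1
    · have := hv (mem_Iio.2 hi) (mem_Iio.2 hi1) h
      omega
    · rw [show i + 1 = n by omega, hvn] at h
      have := hv (mem_Iio.2 hi) (mem_Iio.2 hn) h
      omega
  · intro i hi f hf hinc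
    obtain ⟨j, hj, rfl⟩ := hint (v (i + 1)) (by rw [hw.vertsOf_image hn]; exact ⟨_, hi.le, rfl⟩)
      (fun h => by have := hv (mem_Iio.2 hi) (mem_Iio.2 hn) h; omega) f hf hinc
    rw [mem_Iio] at hj
    rcases hw.eq_or_eq hj hinc with h | h
    · right
      rw [hv (mem_Iio.2 hi) (mem_Iio.2 hj) h]
    · left
      rcases Nat.lt_or_ge (j + 1) n with hj1 | hj1
      · have := hv (mem_Iio.2 hi) (mem_Iio.2 hj1) h
        congr 1
        omega
      · rw [show j + 1 = n by omega, hvn] at h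
        have := hv (mem_Iio.2 hi) (mem_Iio.2 hn) h
        omega

lemma IsCycle.eq_of_subset (hC : G.IsCycle C) (hD : G.IsCycle D) (h : D ⊆ C) : D = C := by
  obtain ⟨x, hx⟩ := hC.vertsOf_nonempty
  obtain ⟨e, he⟩ := hD.nonempty
  exact subset_antisymm h (hC.subset_of_isCycle hx hD (fun _ _ _ f hf _ => h hf) (h he) he)

/-- A cycle in the union of a cycle `C` and a set of edges that has at most one vertex in common
with `C` is either `C` or contained in that set. -/
lemma IsCycle.eq_or_subset (hC : G.IsCycle C) (hD : G.IsCycle D) (hsub : D ⊆ C ∪ Y)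
    (hV : (G.vertsOf C ∩ G.vertsOf Y).Subsingleton) : D = C ∨ D ⊆ Y := by
  by_cases h : ∃ e, e ∈ C ∧ e ∈ D
  · left
    obtain ⟨e, heC, heD⟩ := h
    obtain ⟨x, hx, hxV⟩ : ∃ x ∈ G.vertsOf C, G.vertsOf C ∩ G.vertsOf Y ⊆ {x} := by
      rcases hV.eq_empty_or_singleton with h | ⟨x, h⟩
      · obtain ⟨x, hx⟩ := hC.vertsOf_nonempty
        exact ⟨x, hx, by simp [h]⟩
      · exact ⟨x, (h.symm.subset rfl).1, h.subset⟩
    have := hC.subset_of_isCycle hx hD (fun a ha hax f hf hinc => by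
      rcases hsub hf with hf | hf
      · exact hf
      · exact absurd (hxV ⟨ha, f, hf, hinc⟩) hax) heC heD
    exact (hD.eq_of_subset hC this).symm
  · right
    intro f hf
    exact (hsub hf).resolve_left fun hfC => h ⟨f, hfC, hf⟩

/-- A cycle containing a path has another edge at the end of the path. -/
lemma IsPath.exists_inc_of_subset (h : G.IsPath x y P) (hxy : x ≠ y) (hD : G.IsCycle D)
    (hPD : P ⊆ D) : ∃ f ∈ D, f ∉ P ∧ G.Inc f x := by
  obtain ⟨e, he, z, hz, hl, huniq⟩ := h.inc_unique_left hxy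
  obtain ⟨f, hf, hfe, hinc⟩ := hD.exists_inc_ne (hPD he) hl hz
  exact ⟨f, hf, fun hfP => hfe (huniq f hfP hinc), hinc⟩

lemma IsPath.not_isCycle_subset (h : G.IsPath x y P) (hxy : x ≠ y) (hD : G.IsCycle D) :
    ¬ D ⊆ P := by
  intro hDP
  obtain ⟨e, he⟩ := hD.nonempty
  obtain ⟨f, hf, hfP, -⟩ := h.exists_inc_of_subset hxy hD
    (h.subset_of_isCycle hxy hD (fun _ _ _ _ f hf _ => hDP hf) (hDP he) he)
  exact hfP (hDP hf)

lemma IsPath.symm (h : G.IsPath x y P) (hxy : x ≠ y) : G.IsPath y x P := by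
  obtain ⟨n, v, w, hn, hw, hv, rfl, rfl, rfl⟩ := h.exists_isWalk hxy
  have hR : G.IsWalk (fun i => v (n - i)) (fun i => w (n - 1 - i)) n := by
    intro i hi
    have := (hw (n - 1 - i) (by omega)).symm
    rwa [show n - 1 - i + 1 = n - i by omega,
      show v (n - 1 - i) = v (n - (i + 1)) by congr 1; omega] at this
  have := hR.isPath hn fun i hi j hj hij => by
    rw [mem_Iic] at hi hj
    have := hv (mem_Iic.2 (by omega)) (mem_Iic.2 (by omega)) hij
    omega
  simp only [Nat.sub_zero, Nat.sub_self] at this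
  convert this using 1
  ext f
  constructor
  · rintro ⟨i, hi, rfl⟩
    rw [mem_Iio] at hi
    exact ⟨n - 1 - i, mem_Iio.2 (by omega), by simp only [show n - 1 - (n - 1 - i) = i by omega]⟩
  · rintro ⟨i, hi, rfl⟩
    exact ⟨n - 1 - i, mem_Iio.2 (by omega), rfl⟩

/-- If `f` in `P` were missing from `Q`, the two pieces of `P` on either side of `f`, joined by `Q`,
would close a cycle with `f` inside `P`; but a path contains no cycle. -/
lemma IsPath.eq_of_subset (hP : G.IsPath x y P) (hQ : G.IsPath x y Q) (hxy : x ≠ y)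
    (h : Q ⊆ P) : Q = P := by
  refine subset_antisymm h fun f hf => ?_
  by_contra hfQ
  have hcyc := fun D => hP.not_isCycle_subset (D := D) hxy
  have hc := (hQ.conn hxy).mono (T := P \ {f}) fun e he =>
    ⟨h he, fun h' => hfQ ((mem_singleton_iff.1 h') ▸ he)⟩
  obtain ⟨n, v, w, hn, hw, hv, rfl, rfl, rfl⟩ := hP.exists_isWalk hxy
  obtain ⟨i, hi, rfl⟩ := hf
  rw [mem_Iio] at hi
  have hsub : ∀ j k, k ≤ n → (k ≤ i ∨ i < j) → w '' Ico j k ⊆ w '' Iio n \ {w i} := by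
    rintro j k hk hijk _ ⟨m, ⟨hm1, hm2⟩, rfl⟩
    refine ⟨⟨m, mem_Iio.2 (by omega), rfl⟩, fun h => ?_⟩
    have := hw.injOn_edge hv (mem_Iio.2 (by omega)) (mem_Iio.2 hi) h
    omega
  have h1 := (hw.conn (Nat.zero_le i) hi.le).mono (hsub 0 i hi.le (Or.inl le_rfl))
  have h2 := (hw.conn (Nat.succ_le_of_lt hi) le_rfl).mono
    (hsub (i + 1) n le_rfl (Or.inr (Nat.lt_succ_self i)))
  obtain ⟨D, hD, -, hsub⟩ := (h1.symm.trans (hc.trans h2.symm)).exists_isCycle (hw i hi) (by simp)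
  refine hcyc D hD (hsub.trans ?_)
  rw [insert_sdiff_singleton]
  exact insert_subset ⟨i, hi, rfl⟩ subset_rfl

lemma disjoint_of_subsingleton_inter (hX : X ⊆ G.edgeSet)
    (h : (G.vertsOf X ∩ G.vertsOf Y).Subsingleton)
    (hl : ∀ e ∈ X, e ∈ Y → ∀ a, ¬ G.IsLink e a a) : Disjoint X Y := by
  rw [Set.disjoint_left]
  intro e heX heY
  obtain ⟨a, b, hab⟩ := exists_isLink_of_mem_edgeSet (hX heX)
  have : a = b := h ⟨⟨e, heX, hab.inc_left⟩, ⟨e, heY, hab.inc_left⟩⟩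
    ⟨⟨e, heX, hab.inc_right⟩, ⟨e, heY, hab.inc_right⟩⟩
  subst this
  exact hl e heX heY a hab

/-! ### Thetas -/

lemma IsTheta.swap_left (h : G.IsTheta P Q R) : G.IsTheta Q P R := by
  obtain ⟨x, y, hxy, hP, hQ, hR, h1, h2, h3, h4, h5, h6⟩ := h
  exact ⟨x, y, hxy, hQ, hP, hR, h1.symm, h3, h2, by rwa [inter_comm], h6, h5⟩

lemma IsTheta.swap_right (h : G.IsTheta P Q R) : G.IsTheta P R Q := by
  obtain ⟨x, y, hxy, hP, hQ, hR, h1, h2, h3, h4, h5, h6⟩ := h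
  exact ⟨x, y, hxy, hP, hR, hQ, h2, h1, h3.symm, h5, h4, by rwa [inter_comm]⟩

lemma IsTheta.rotate (h : G.IsTheta P Q R) : G.IsTheta Q R P := h.swap_left.swap_right

lemma IsTheta.isCycle (h : G.IsTheta P Q R) : G.IsCycle (P ∪ Q) := by
  obtain ⟨x, y, hxy, hP, hQ, -, h1, -, -, h4, -, -⟩ := h
  exact hP.union_isCycle hQ hxy h1 h4.subset

lemma IsTheta.nonempty (h : G.IsTheta P Q R) : P.Nonempty := by
  obtain ⟨x, y, hxy, hP, -⟩ := h
  exact hP.nonempty hxy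

lemma IsTheta.disjoint (h : G.IsTheta P Q R) : Disjoint P Q := by
  obtain ⟨x, y, -, -, -, -, h1, -⟩ := h
  exact h1

lemma IsTheta.union_ne (h : G.IsTheta P Q R) : P ∪ Q ≠ P ∪ R := by
  intro heq
  obtain ⟨q, hq⟩ := h.swap_left.nonempty
  rcases heq.subset (Or.inr hq) with hq' | hq'
  · exact Set.disjoint_left.1 h.disjoint hq' hq
  · exact Set.disjoint_left.1 h.swap_left.swap_right.disjoint hq hq'

/-- The interior vertices of each path meet no other edges of the theta, so `D` contains each path
wholly or not at all. Having traversed `P`, it must continue into `Q` or `R`, and then it contains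
one of the cycles of the theta. -/
lemma IsTheta.union_mem_of_mem {e : E} (h : G.IsTheta P Q R) (hD : G.IsCycle D)
    (hsub : D ⊆ P ∪ Q ∪ R) (heP : e ∈ P) (heD : e ∈ D) : D = P ∪ Q ∨ D = P ∪ R := by
  have h' := h
  obtain ⟨x, y, hxy, hP, hQ, hR, h1, h2, h3, h4, h5, h6⟩ := h
  have key : ∀ {P Q R : Set E}, G.IsPath x y P → G.vertsOf P ∩ G.vertsOf Q = {x, y} →
      G.vertsOf P ∩ G.vertsOf R = {x, y} → D ⊆ P ∪ Q ∪ R → ∀ e ∈ P, e ∈ D → P ⊆ D := by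
    intro P Q R hP h4 h5 hsub e heP heD
    refine hP.subset_of_isCycle hxy hD ?_ heP heD
    intro a ha hax hay f hf hinc
    rcases hsub hf with (hf | hf) | hf
    · exact hf
    · have : a ∈ ({x, y} : Set V) := h4 ▸ ⟨ha, f, hf, hinc⟩
      simp [hax, hay] at this
    · have : a ∈ ({x, y} : Set V) := h5 ▸ ⟨ha, f, hf, hinc⟩
      simp [hax, hay] at this
  have hPD := key hP h4 h5 hsub e heP heD
  obtain ⟨f, hfD, hfP, -⟩ := hP.exists_inc_of_subset hxy hD hPD
  rcases hsub hfD with (hf | hf) | hf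
  · exact absurd hf hfP
  · left
    refine (hD.eq_of_subset h'.isCycle (union_subset hPD ?_)).symm
    exact key hQ (R := R) (by rw [inter_comm]; exact h4) h6 (by rwa [union_comm Q P]) f hf hfD
  · right
    refine (hD.eq_of_subset h'.swap_right.isCycle (union_subset hPD ?_)).symm
    exact key hR (Q := P) (R := Q) (by rw [inter_comm]; exact h5) (by rw [inter_comm]; exact h6)
      (by rwa [union_assoc, union_comm R]) f hf hfD

/-- A theta contains exactly three cycles. -/
lemma IsTheta.eq_of_isCycle (h : G.IsTheta P Q R) (hD : G.IsCycle D) (hsub : D ⊆ P ∪ Q ∪ R) :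
    D = P ∪ Q ∨ D = P ∪ R ∨ D = Q ∪ R := by
  obtain ⟨e, he⟩ := hD.nonempty
  rcases hsub he with (he' | he') | he'
  · rcases h.union_mem_of_mem hD hsub he' he with h | h <;> simp [h]
  · rcases h.swap_left.union_mem_of_mem hD (by rwa [union_comm Q P]) he' he with h | h
    · simp [h, union_comm]
    · simp [h]
  · rcases h.swap_right.swap_left.union_mem_of_mem hD (by rwa [union_assoc, union_comm R])
      he' he with h | h
    · simp [h, union_comm]
    · simp [h, union_comm]

/-- A set of edges joining two vertices of a cycle `D`, which are not joined by its edges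
in `D`, contains a path that forms a theta together with `D`. -/
lemma IsCycle.exists_isTheta (hD : G.IsCycle D) (hx : x ∈ G.vertsOf D) (hy : y ∈ G.vertsOf D)
    (h : G.Conn S x y) (hxy : ¬ G.Conn (S ∩ D) x y) :
    ∃ P Q R, G.IsTheta P Q R ∧ P ⊆ S \ D ∧ Q ∪ R = D := by
  obtain ⟨n, v, w, hn, hw, hS, ⟨h1, h2, h3⟩, hv, hmin⟩ := h.exists_shortest_isWalk
    (fun a b => a ∈ G.vertsOf D ∧ b ∈ G.vertsOf D ∧ ¬ G.Conn (S ∩ D) a b)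
    (fun a h => h.2.2 (Conn.refl _ _ _)) ⟨hx, hy, hxy⟩
  -- A vertex of `D` inside the walk is either joined to `v 0` in `S ∩ D`, and the rest of the walk
  -- is a shorter candidate, or it is not, and the initial part is one.
  have hint : ∀ i, 0 < i → i < n → v i ∉ G.vertsOf D := by
    intro i hi0 hin hi
    by_cases hc : G.Conn (S ∩ D) (v 0) (v i)
    · have := hmin i n hin le_rfl ⟨hi, h2, fun h => h3 (hc.trans h)⟩
      omega
    · have := hmin 0 i hi0 hin.le ⟨h1, hi, hc⟩
      omega
  have hd : ∀ i < n, w i ∉ D := by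
    intro i hi hiD
    have hl := hw i hi
    have hi0 : i = 0 := by
      by_contra hi0
      exact hint i (by omega) hi ⟨_, hiD, hl.inc_left⟩
    have hin : i + 1 = n := by
      by_contra hin
      exact hint (i + 1) (by omega) (by omega) ⟨_, hiD, hl.inc_right⟩
    rw [hin, hi0] at hl
    exact h3 (Conn.of_isLink hl ⟨hS 0 (by omega), hi0 ▸ hiD⟩)
  have hne : v 0 ≠ v n := fun h => h3 (h ▸ Conn.refl _ _ _)
  obtain ⟨Q, R, hQ, hR, hQR, rfl, hV⟩ := hD.exists_split h1 h2 hne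
  have hPD : w '' Iio n ⊆ S \ (Q ∪ R) := by
    rintro _ ⟨i, hi, rfl⟩
    exact ⟨hS i hi, hd i hi⟩
  have hPV : G.vertsOf (w '' Iio n) ∩ G.vertsOf (Q ∪ R) ⊆ {v 0, v n} := by
    rw [hw.vertsOf_image hn]
    rintro _ ⟨⟨i, hi, rfl⟩, hiD⟩
    rcases Nat.eq_zero_or_pos i with rfl | hi0
    · exact Or.inl rfl
    · rcases (mem_Iic.1 hi).lt_or_eq with hi | rfl
      · exact absurd hiD (hint i hi0 hi)
      · exact Or.inr rfl
  have hP := hw.isPath hn hv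
  have hends : {v 0, v n} ⊆ G.vertsOf (w '' Iio n) := by
    rw [hw.vertsOf_image hn]
    rintro _ (rfl | rfl)
    · exact ⟨0, by simp, rfl⟩
    · exact ⟨n, by simp, rfl⟩
  refine ⟨w '' Iio n, Q, R, ⟨v 0, v n, hne, hP, hQ, hR, ?_, ?_, hQR, ?_, ?_, hV⟩, hPD, rfl⟩
  · exact Set.disjoint_left.2 fun f hf hf' => (hPD hf).2 (Or.inl hf')
  · exact Set.disjoint_left.2 fun f hf hf' => (hPD hf).2 (Or.inr hf')
  · refine subset_antisymm ((inter_subset_inter_right _ (vertsOf_mono subset_union_left)).trans hPV)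
      (subset_inter hends (hV.symm.subset.trans inter_subset_left))
  · refine subset_antisymm ((inter_subset_inter_right _ (vertsOf_mono subset_union_right)).trans hPV)
      (subset_inter hends (hV.symm.subset.trans inter_subset_right))

/-- If two distinct cycles have at least two common vertices, then one of them contains a path that
forms a theta together with the other. -/
lemma IsCycle.exists_isTheta_of_isCycle (hC : G.IsCycle C) (hD : G.IsCycle D) (hCD : C ≠ D)
    (hx : x ∈ G.vertsOf C ∩ G.vertsOf D) (hy : y ∈ G.vertsOf C ∩ G.vertsOf D) (hxy : x ≠ y) :
    ∃ P Q R, G.IsTheta P Q R ∧ P ⊆ C \ D ∧ Q ∪ R = D := by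
  classical
  suffices h : ∃ a ∈ G.vertsOf D, ∃ b ∈ G.vertsOf D, a ≠ b ∧ G.Conn (C \ D) a b by
    obtain ⟨a, ha, b, hb, hab, h⟩ := h
    obtain ⟨P, Q, R, hT, hP, hQR⟩ := hD.exists_isTheta ha hb h (fun h' => by
      rw [sdiff_inter_self] at h'
      rcases Relation.ReflTransGen.cases_head h' with rfl | ⟨_, ⟨e, he, -⟩, -⟩
      · exact hab rfl
      · exact he)
    exact ⟨P, Q, R, hT, hP.trans sdiff_subset, hQR⟩
  obtain ⟨f, hfC, hfD⟩ : ∃ f ∈ C, f ∉ D := by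
    by_contra! h
    exact hCD (hD.eq_of_subset hC h)
  obtain ⟨n, v, w, hn, hw, hv, -, hvn, rfl, rfl⟩ := hC.exists_isWalk hx.1
  obtain ⟨i, hi, rfl⟩ := hfC
  rw [mem_Iio] at hi
  have hnV : v n ∈ G.vertsOf D := hvn ▸ hx.2
  have hex : ∃ k, i < k ∧ v k ∈ G.vertsOf D := ⟨n, hi, hnV⟩
  obtain ⟨hk1, hk2⟩ := Nat.find_spec hex
  have hkn : Nat.find hex ≤ n := Nat.find_min' hex ⟨hi, hnV⟩
  have hkmin : ∀ m, i < m → v m ∈ G.vertsOf D → Nat.find hex ≤ m :=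
    fun m h1 h2 => Nat.find_min' hex ⟨h1, h2⟩
  generalize Nat.find hex = k at *
  have hj1 : Nat.findGreatest (fun j => v j ∈ G.vertsOf D) i ≤ i := Nat.findGreatest_le i
  have hj2 : v (Nat.findGreatest (fun j => v j ∈ G.vertsOf D) i) ∈ G.vertsOf D :=
    Nat.findGreatest_spec (P := fun j => v j ∈ G.vertsOf D) (Nat.zero_le i) hx.2
  have hjmax : ∀ m ≤ i, v m ∈ G.vertsOf D →
      m ≤ Nat.findGreatest (fun j => v j ∈ G.vertsOf D) i :=
    fun m h1 h2 => Nat.le_findGreatest h1 h2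
  generalize Nat.findGreatest (fun j => v j ∈ G.vertsOf D) i = j at *
  -- Around the edge `w i` outside `D`, the indices `j ≤ i < k` are the nearest ones whose vertices
  -- lie on `D`, so no edge between them is in `D`. If `v j = v k`, the segment would be all of `C`,
  -- and the second common vertex would lie in its interior.
  refine ⟨v j, hj2, v k, hk2, ?_, (hw.conn (by omega) hkn).mono ?_⟩
  · intro hjk
    rcases hkn.lt_or_eq with hkn | rfl
    · have := hv (mem_Iio.2 (by omega)) (mem_Iio.2 hkn) hjk
      omega
    · have hj0 : j = 0 := hv (mem_Iio.2 (by omega)) (mem_Iio.2 hn) (hjk.trans hvn)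
      obtain ⟨hyC, hyD⟩ := hy
      rw [hw.vertsOf_image hn] at hyC
      obtain ⟨l, hl, rfl⟩ := hyC
      have hl0 : l ≠ 0 := fun h => hxy (by rw [h])
      have hlk : l ≠ k := fun h => hxy (by rw [h, hvn])
      rw [mem_Iic] at hl
      rcases Nat.lt_or_ge i l with h | h
      · have := hkmin l h hyD
        omega
      · have := hjmax l h hyD
        omega
  · rintro _ ⟨m, ⟨hm1, hm2⟩, rfl⟩
    refine ⟨⟨m, mem_Iio.2 (by omega), rfl⟩, fun hmD => ?_⟩
    have hl := hw m (by omega)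
    rcases lt_trichotomy m i with hmi | rfl | hmi
    · have := hjmax (m + 1) hmi ⟨_, hmD, hl.inc_right⟩
      omega
    · exact hfD hmD
    · have := hkmin m hmi ⟨_, hmD, hl.inc_left⟩
      omega

/-- Cycle elimination. -/
lemma IsCycle.exists_isCycle_diff (hC : G.IsCycle C) (hD : G.IsCycle D) (hCD : C ≠ D)
    (heC : e ∈ C) (heD : e ∈ D) : ∃ F, G.IsCycle F ∧ F ⊆ (C ∪ D) \ {e} := by
  obtain ⟨x, y, hl⟩ := exists_isLink_of_mem_edgeSet (hC.subset_edgeSet heC)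
  rcases eq_or_ne x y with rfl | hxy
  · have hs := isCycle_singleton hl
    have h1 := hC.eq_of_subset hs (by simpa using heC)
    have h2 := hD.eq_of_subset hs (by simpa using heD)
    exact absurd (h1.symm.trans h2) hCD
  · obtain ⟨P, Q, R, hT, hP, rfl⟩ := hC.exists_isTheta_of_isCycle hD hCD
      ⟨⟨e, heC, hl.inc_left⟩, ⟨e, heD, hl.inc_left⟩⟩
      ⟨⟨e, heC, hl.inc_right⟩, ⟨e, heD, hl.inc_right⟩⟩ hxy
    have heP : e ∉ P := fun h => (hP h).2 heD
    have hQR := hT.rotate.disjoint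
    -- The edge lies on one side of the theta, and `P` together with the other side is a cycle
    -- avoiding it.
    rcases heD with he | he
    · refine ⟨P ∪ R, hT.swap_right.isCycle, ?_⟩
      rintro f (hf | hf)
      · exact ⟨Or.inl (hP hf).1, fun h => heP (h ▸ hf)⟩
      · exact ⟨Or.inr (Or.inr hf), fun h => Set.disjoint_left.1 hQR he (h ▸ hf)⟩
    · refine ⟨P ∪ Q, hT.isCycle, ?_⟩
      rintro f (hf | hf)
      · exact ⟨Or.inl (hP hf).1, fun h => heP (h ▸ hf)⟩
      · exact ⟨Or.inr (Or.inl hf), fun h => Set.disjoint_left.1 hQR (h ▸ hf) he⟩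

lemma IsTheta.nonempty_inter (h : G.IsTheta P Q R) : (G.vertsOf P ∩ G.vertsOf Q).Nonempty := by
  obtain ⟨x, y, -, -, -, -, -, -, -, h4, -, -⟩ := h
  exact ⟨x, h4 ▸ Or.inl rfl⟩

/-! ### Handcuffs -/

lemma IsCycle.disjoint (hC : G.IsCycle C) (hD : G.IsCycle D) (hCD : C ≠ D)
    (h : (G.vertsOf C ∩ G.vertsOf D).Subsingleton) : Disjoint C D :=
  disjoint_of_subsingleton_inter hC.subset_edgeSet h fun e heC heD a ha => hCD <| by
    have hs := isCycle_singleton ha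
    rw [← hC.eq_of_subset hs (by simpa using heC), ← hD.eq_of_subset hs (by simpa using heD)]

lemma IsCycle.ne_of_disjoint (hC : G.IsCycle C)
    (h : Disjoint (G.vertsOf C) (G.vertsOf D)) : C ≠ D := by
  rintro rfl
  exact hC.vertsOf_nonempty.ne_empty (disjoint_self.1 h)

lemma IsCycle.eq_or_eq (hC : G.IsCycle C) (hC' : G.IsCycle C') (hD : G.IsCycle D)
    (hV : (G.vertsOf C ∩ G.vertsOf C').Subsingleton) (h : D ⊆ C ∪ C') : D = C ∨ D = C' :=
  (hC.eq_or_subset hD h hV).imp_right fun h => hC'.eq_of_subset hD h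

lemma IsLooseHandcuffs.symm (h : G.IsLooseHandcuffs C C' P) : G.IsLooseHandcuffs C' C P := by
  obtain ⟨hC, hC', hd, x, y, hP, hx, hy⟩ := h
  have hxy : x ≠ y := by
    rintro rfl
    exact Set.disjoint_left.1 hd (hx.symm.subset rfl).2 (hy.symm.subset rfl).2
  exact ⟨hC', hC, hd.symm, y, x, hP.symm hxy, hy, hx⟩

lemma IsLooseHandcuffs.exists_isPath (h : G.IsLooseHandcuffs C C' P) :
    ∃ x y, x ≠ y ∧ G.IsPath x y P ∧ G.vertsOf P ∩ G.vertsOf C = {x} ∧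
      G.vertsOf P ∩ G.vertsOf C' = {y} := by
  obtain ⟨hC, hC', hd, x, y, hP, hx, hy⟩ := h
  refine ⟨x, y, ?_, hP, hx, hy⟩
  rintro rfl
  exact Set.disjoint_left.1 hd (hx.symm.subset rfl).2 (hy.symm.subset rfl).2

/-- Each end cycle meets the rest in one vertex and can be peeled off; the remaining path contains
no cycle. -/
lemma IsLooseHandcuffs.eq_or_eq (h : G.IsLooseHandcuffs C C' P) (hD : G.IsCycle D)
    (hsub : D ⊆ C ∪ C' ∪ P) : D = C ∨ D = C' := by
  obtain ⟨x, y, hxy, hP, hx, hy⟩ := h.exists_isPath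
  rw [union_assoc] at hsub
  rcases h.1.eq_or_subset hD hsub (by
    rw [vertsOf_union, inter_union_distrib_left, h.2.2.1.inter_eq, empty_union, inter_comm, hx]
    exact subsingleton_singleton) with h1 | h1
  · exact Or.inl h1
  · rcases h.2.1.eq_or_subset hD h1 (by rw [inter_comm, hy]; exact subsingleton_singleton)
      with h2 | h2
    · exact Or.inr h2
    · exact absurd h2 (hP.not_isCycle_subset hxy hD)

lemma IsLooseHandcuffs.disjoint (h : G.IsLooseHandcuffs C C' P) : Disjoint P C := by
  obtain ⟨x, y, hxy, hP, hx, hy⟩ := h.exists_isPath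
  refine disjoint_of_subsingleton_inter hP.subset_edgeSet (by rw [hx]; exact subsingleton_singleton)
    fun e he _ a ha => ?_
  exact hP.not_isCycle_subset hxy (isCycle_singleton ha) (by simpa using he)

/-- Loose handcuffs with the same two cycles form an antichain. -/
lemma IsLooseHandcuffs.eq_of_subset (h : G.IsLooseHandcuffs C C' P)
    (h' : G.IsLooseHandcuffs C C' Q) (hsub : Q ⊆ C ∪ C' ∪ P) : Q = P := by
  obtain ⟨x, y, hxy, hP, hx, hy⟩ := h.exists_isPath
  obtain ⟨x', y', hxy', hQ, hx', hy'⟩ := h'.exists_isPath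
  have hQP : Q ⊆ P := by
    intro f hf
    rcases hsub hf with (h1 | h1) | h1
    · exact absurd h1 (Set.disjoint_left.1 h'.disjoint hf)
    · exact absurd h1 (Set.disjoint_left.1 h'.symm.disjoint hf)
    · exact h1
  have e1 : x' = x := by
    have := hx'.symm.subset rfl
    exact hx.subset ⟨vertsOf_mono hQP this.1, this.2⟩
  have e2 : y' = y := by
    have := hy'.symm.subset rfl
    exact hy.subset ⟨vertsOf_mono hQP this.1, this.2⟩
  subst e1 e2
  exact hP.eq_of_subset hQ hxy hQP

/-- Two vertex-disjoint cycles connected by `X` are joined in `X` to loose handcuffs. -/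
lemma exists_isLooseHandcuffs (hC : G.IsCycle C) (hD : G.IsCycle D)
    (hd : Disjoint (G.vertsOf C) (G.vertsOf D)) (ha : a ∈ G.vertsOf C) (hb : b ∈ G.vertsOf D)
    (h : G.Conn X a b) : ∃ P ⊆ X, G.IsLooseHandcuffs C D P := by
  obtain ⟨n, v, w, hn, hw, hX, ⟨h1, h2⟩, hv, hmin⟩ := h.exists_shortest_isWalk
    (fun a b => a ∈ G.vertsOf C ∧ b ∈ G.vertsOf D)
    (fun a h => Set.disjoint_left.1 hd h.1 h.2) ⟨ha, hb⟩
  refine ⟨w '' Iio n, image_subset_iff.2 hX, hC, hD, hd, v 0, v n, hw.isPath hn hv, ?_, ?_⟩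
  · rw [hw.vertsOf_image hn]
    refine subset_antisymm ?_ (singleton_subset_iff.2 ⟨⟨0, by simp, rfl⟩, h1⟩)
    rintro _ ⟨⟨i, hi, rfl⟩, hiC⟩
    rcases (mem_Iic.1 hi).lt_or_eq with hi | rfl
    · rw [(hmin i n hi le_rfl ⟨hiC, h2⟩).1]; rfl
    · exact absurd h2 (Set.disjoint_left.1 hd hiC)
  · rw [hw.vertsOf_image hn]
    refine subset_antisymm ?_ (singleton_subset_iff.2 ⟨⟨n, by simp, rfl⟩, h2⟩)
    rintro _ ⟨⟨i, hi, rfl⟩, hiD⟩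
    rcases Nat.eq_zero_or_pos i with rfl | hi0
    · exact absurd hiD (Set.disjoint_left.1 hd h1)
    · rw [(hmin 0 i hi0 hi ⟨h1, hiD⟩).2]; rfl

/-! ### Circuits and independent sets for a dependence relation on pairs of disjoint cycles -/

/-- The circuits of the matroid given by a biased graph `(G, 𝓑)` and a relation `Dep`, which says
which pairs of vertex-disjoint unbalanced cycles are circuits. -/
def pairCircuits (G : Graph V E) (𝓑 : Set (Set E)) (Dep : Set E → Set E → Prop) : Set (Set E) :=
  {X | X ∈ 𝓑 ∨
    (∃ P Q R, G.IsTheta P Q R ∧ P ∪ Q ∉ 𝓑 ∧ P ∪ R ∉ 𝓑 ∧ Q ∪ R ∉ 𝓑 ∧ X = P ∪ Q ∪ R) ∨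
    (∃ C C', G.IsTightHandcuffs C C' ∧ C ∉ 𝓑 ∧ C' ∉ 𝓑 ∧ X = C ∪ C') ∨
    (∃ C C', G.IsCycle C ∧ G.IsCycle C' ∧ Disjoint (G.vertsOf C) (G.vertsOf C') ∧
      C ∉ 𝓑 ∧ C' ∉ 𝓑 ∧ Dep C C' ∧ X = C ∪ C') ∨
    (∃ C C' P, G.IsLooseHandcuffs C C' P ∧ C ∉ 𝓑 ∧ C' ∉ 𝓑 ∧ ¬ Dep C C' ∧ X = C ∪ C' ∪ P)}

/-- No component of `X` contains two cycles. -/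
def SeparatesCycles (G : Graph V E) (X : Set E) : Prop :=
  ∀ C D, G.IsCycle C → G.IsCycle D → C ⊆ X → D ⊆ X → C ≠ D →
    ∀ a ∈ G.vertsOf C, ∀ b ∈ G.vertsOf D, ¬ G.Conn X a b

lemma SeparatesCycles.mono (h : G.SeparatesCycles X) (hYX : Y ⊆ X) : G.SeparatesCycles Y :=
  fun C D hC hD hCX hDX hne a ha b hb hab =>
    h C D hC hD (hCX.trans hYX) (hDX.trans hYX) hne a ha b hb (hab.mono hYX)

lemma SeparatesCycles.disjoint (h : G.SeparatesCycles X) (hC : G.IsCycle C) (hD : G.IsCycle D)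
    (hCX : C ⊆ X) (hDX : D ⊆ X) (hne : C ≠ D) : Disjoint (G.vertsOf C) (G.vertsOf D) :=
  Set.disjoint_left.2 fun a ha ha' => h C D hC hD hCX hDX hne a ha a ha' (Conn.refl _ _ _)

/-- A structural description of the sets of edges containing no member of `G.pairCircuits 𝓑 Dep`. -/
structure PairIndep (G : Graph V E) (𝓑 : Set (Set E)) (Dep : Set E → Set E → Prop)
    (X : Set E) : Prop where
  subset_edgeSet : X ⊆ G.edgeSet
  notMem : ∀ C, G.IsCycle C → C ⊆ X → C ∉ 𝓑
  separates : G.SeparatesCycles X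
  not_dep : ∀ C D, G.IsCycle C → G.IsCycle D → C ⊆ X → D ⊆ X → C ≠ D → ¬ Dep C D

lemma PairIndep.mono (h : G.PairIndep 𝓑 Dep X) (hYX : Y ⊆ X) : G.PairIndep 𝓑 Dep Y where
  subset_edgeSet := hYX.trans h.subset_edgeSet
  notMem C hC hCY := h.notMem C hC (hCY.trans hYX)
  separates := h.separates.mono hYX
  not_dep C D hC hD hCY hDY := h.not_dep C D hC hD (hCY.trans hYX) (hDY.trans hYX)

/-- Two distinct unbalanced cycles inside a circuit-free `X` are disjoint: one common vertex gives
tight handcuffs, several give a theta whose three cycles lie in `X` and hence are unbalanced. If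
disjoint, they are not dependent, so a connection in `X` would give loose handcuffs. -/
lemma pairIndep_iff (h𝓑 : G.IsBiased 𝓑) :
    G.PairIndep 𝓑 Dep X ↔ X ⊆ G.edgeSet ∧ ∀ Y ∈ G.pairCircuits 𝓑 Dep, ¬ Y ⊆ X := by
  constructor
  · refine fun h => ⟨h.subset_edgeSet, ?_⟩
    rintro Y (hY | ⟨P, Q, R, hT, -, -, -, rfl⟩ | ⟨C, C', ⟨hC, hC', hd, x, hx⟩, -, -, rfl⟩ |
      ⟨C, C', hC, hC', hd, -, -, hdep, rfl⟩ | ⟨C, C', P, hL, -, -, -, rfl⟩) hYX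
    · exact h.notMem Y (h𝓑.isCycle Y hY) hYX hY
    · obtain ⟨a, ha, -⟩ := hT.nonempty_inter
      exact h.separates (P ∪ Q) (P ∪ R) hT.isCycle hT.swap_right.isCycle
        (subset_union_left.trans hYX)
        ((union_subset_union_left _ subset_union_left).trans hYX) hT.union_ne
        a (vertsOf_mono subset_union_left ha) a (vertsOf_mono subset_union_left ha)
        (Conn.refl _ _ _)
    · have hx' := hx.symm.subset rfl
      refine h.separates C C' hC hC' (subset_union_left.trans hYX) (subset_union_right.trans hYX)
        ?_ x hx'.1 x hx'.2 (Conn.refl _ _ _)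
      rintro rfl
      exact hC.nonempty.ne_empty (disjoint_self.1 hd)
    · exact h.not_dep C C' hC hC' (subset_union_left.trans hYX) (subset_union_right.trans hYX)
        (hC.ne_of_disjoint hd) hdep
    · obtain ⟨x, y, hxy, hP, hx, hy⟩ := hL.exists_isPath
      rw [union_subset_iff, union_subset_iff] at hYX
      exact h.separates C C' hL.1 hL.2.1 hYX.1.1 hYX.1.2 (hL.1.ne_of_disjoint hL.2.2.1)
        x (hx.symm.subset rfl).2 y (hy.symm.subset rfl).2 ((hP.conn hxy).mono hYX.2)
  · rintro ⟨hE, h⟩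
    have hbal : ∀ C, G.IsCycle C → C ⊆ X → C ∉ 𝓑 := fun C _ hCX hC => h C (Or.inl hC) hCX
    have hdisj : ∀ C D, G.IsCycle C → G.IsCycle D → C ⊆ X → D ⊆ X → C ≠ D →
        Disjoint (G.vertsOf C) (G.vertsOf D) := by
      intro C D hC hD hCX hDX hne
      by_cases hs : (G.vertsOf C ∩ G.vertsOf D).Subsingleton
      · rcases hs.eq_empty_or_singleton with h0 | ⟨x, hx⟩
        · exact Set.disjoint_iff_inter_eq_empty.2 h0
        · exact absurd (union_subset hCX hDX) (h _ (Or.inr (Or.inr (Or.inl ⟨C, D,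
            ⟨hC, hD, hC.disjoint hD hne hs, x, hx⟩, hbal C hC hCX, hbal D hD hDX, rfl⟩))))
      · obtain ⟨x, hx, y, hy, hxy⟩ := Set.not_subsingleton_iff.1 hs
        obtain ⟨P, Q, R, hT, hP, rfl⟩ := hC.exists_isTheta_of_isCycle hD hne hx hy hxy
        have hPX : P ⊆ X := hP.trans (sdiff_subset.trans hCX)
        rw [union_subset_iff] at hDX
        exact absurd (union_subset (union_subset hPX hDX.1) hDX.2)
          (h _ (Or.inr (Or.inl ⟨P, Q, R, hT, hbal _ hT.isCycle (union_subset hPX hDX.1),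
            hbal _ hT.swap_right.isCycle (union_subset hPX hDX.2),
            hbal _ hD (union_subset hDX.1 hDX.2), rfl⟩)))
    have hdep : ∀ C D, G.IsCycle C → G.IsCycle D → C ⊆ X → D ⊆ X → C ≠ D → ¬ Dep C D :=
      fun C D hC hD hCX hDX hne hdep => h _ (Or.inr (Or.inr (Or.inr (Or.inl ⟨C, D, hC, hD,
        hdisj C D hC hD hCX hDX hne, hbal C hC hCX, hbal D hD hDX, hdep, rfl⟩))))
        (union_subset hCX hDX)
    refine ⟨hE, hbal, ?_, hdep⟩
    intro C D hC hD hCX hDX hne a ha b hb hab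
    obtain ⟨P, hPX, hL⟩ := exists_isLooseHandcuffs hC hD (hdisj C D hC hD hCX hDX hne) ha hb hab
    exact h _ (Or.inr (Or.inr (Or.inr (Or.inr ⟨C, D, P, hL, hbal C hC hCX, hbal D hD hDX,
      hdep C D hC hD hCX hDX hne, rfl⟩)))) (union_subset (union_subset hCX hDX) hPX)

/-- The cycles contained in a circuit that is not a balanced cycle. -/
lemma cycles_of_mem_pairCircuits (hsymm : ∀ C D, Dep C D → Dep D C)
    (hX : X ∈ G.pairCircuits 𝓑 Dep) (hX𝓑 : X ∉ 𝓑) :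
    (∀ C, G.IsCycle C → C ⊆ X → C ∉ 𝓑) ∧
    (∃ C D, G.IsCycle C ∧ G.IsCycle D ∧ C ≠ D ∧ C ⊆ X ∧ D ⊆ X) ∧
    (∀ C D, G.IsCycle C → G.IsCycle D → C ≠ D → C ⊆ X → D ⊆ X →
      (X = C ∪ D ∧ (Dep C D ∨ ¬ Disjoint (G.vertsOf C) (G.vertsOf D))) ∨
      ∃ P, G.IsLooseHandcuffs C D P ∧ ¬ Dep C D ∧ X = C ∪ D ∪ P) := by
  rcases hX with hX | ⟨P, Q, R, hT, h1, h2, h3, rfl⟩ |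
    ⟨C, C', ⟨hC, hC', hd, x, hx⟩, h1, h2, rfl⟩ |
    ⟨C, C', hC, hC', hd, h1, h2, hdep, rfl⟩ | ⟨C, C', P, hL, h1, h2, h3, rfl⟩
  · exact absurd hX hX𝓑
  · refine ⟨fun C hC hCX => ?_, ⟨P ∪ Q, P ∪ R, hT.isCycle, hT.swap_right.isCycle, hT.union_ne,
      subset_union_left, union_subset_union_left _ subset_union_left⟩, fun C D hC hD hne hCX hDX => ?_⟩
    · rcases hT.eq_of_isCycle hC hCX with rfl | rfl | rfl <;> assumption
    · have key : ∀ {P Q R : Set E}, G.IsTheta P Q R →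
          ¬ Disjoint (G.vertsOf (P ∪ Q)) (G.vertsOf (P ∪ R)) := by
        intro P Q R hT hd
        obtain ⟨a, ha, -⟩ := hT.nonempty_inter
        exact Set.disjoint_left.1 hd (vertsOf_mono subset_union_left ha)
          (vertsOf_mono subset_union_left ha)
      left
      rcases hT.eq_of_isCycle hC hCX with rfl | rfl | rfl <;>
      rcases hT.eq_of_isCycle hD hDX with rfl | rfl | rfl
      · exact absurd rfl hne
      · exact ⟨by ext; simp only [mem_union]; tauto, Or.inr (key hT)⟩
      · refine ⟨by ext; simp only [mem_union]; tauto, Or.inr ?_⟩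
        rw [union_comm P]
        exact key hT.swap_left
      · exact ⟨by ext; simp only [mem_union]; tauto, Or.inr (key hT.swap_right)⟩
      · exact absurd rfl hne
      · refine ⟨by ext; simp only [mem_union]; tauto, Or.inr ?_⟩
        rw [union_comm P, union_comm Q]
        exact key hT.swap_right.swap_left
      · refine ⟨by ext; simp only [mem_union]; tauto, Or.inr ?_⟩
        rw [union_comm P]
        exact key hT.rotate
      · refine ⟨by ext; simp only [mem_union]; tauto, Or.inr ?_⟩
        rw [union_comm P, union_comm Q]
        exact key hT.rotate.rotate.swap_right
      · exact absurd rfl hne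
  · have hs : (G.vertsOf C ∩ G.vertsOf C').Subsingleton := by
      rw [hx]; exact subsingleton_singleton
    have hx' := hx.symm.subset rfl
    refine ⟨fun D hD hDX => ?_, ⟨C, C', hC, hC', ?_, subset_union_left, subset_union_right⟩,
      fun D D' hD hD' hne hDX hDX' => Or.inl ?_⟩
    · rcases hC.eq_or_eq hC' hD hs hDX with rfl | rfl <;> assumption
    · rintro rfl
      exact hC.nonempty.ne_empty (disjoint_self.1 hd)
    · rcases hC.eq_or_eq hC' hD hs hDX with rfl | rfl <;>
      rcases hC.eq_or_eq hC' hD' hs hDX' with rfl | rfl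
      · exact absurd rfl hne
      · exact ⟨rfl, Or.inr fun h => Set.disjoint_left.1 h hx'.1 hx'.2⟩
      · exact ⟨union_comm _ _, Or.inr fun h => Set.disjoint_left.1 h hx'.2 hx'.1⟩
      · exact absurd rfl hne
  · have hs : (G.vertsOf C ∩ G.vertsOf C').Subsingleton := by
      rw [hd.inter_eq]; exact subsingleton_empty
    refine ⟨fun D hD hDX => ?_, ⟨C, C', hC, hC', hC.ne_of_disjoint hd, subset_union_left,
      subset_union_right⟩, fun D D' hD hD' hne hDX hDX' => Or.inl ?_⟩
    · rcases hC.eq_or_eq hC' hD hs hDX with rfl | rfl <;> assumption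
    · rcases hC.eq_or_eq hC' hD hs hDX with rfl | rfl <;>
      rcases hC.eq_or_eq hC' hD' hs hDX' with rfl | rfl
      · exact absurd rfl hne
      · exact ⟨rfl, Or.inl hdep⟩
      · exact ⟨union_comm _ _, Or.inl (hsymm _ _ hdep)⟩
      · exact absurd rfl hne
  · refine ⟨fun D hD hDX => ?_, ⟨C, C', hL.1, hL.2.1, hL.1.ne_of_disjoint hL.2.2.1,
      subset_union_left.trans subset_union_left, subset_union_right.trans subset_union_left⟩,
      fun D D' hD hD' hne hDX hDX' => Or.inr ?_⟩
    · rcases hL.eq_or_eq hD hDX with rfl | rfl <;> assumption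
    · rcases hL.eq_or_eq hD hDX with rfl | rfl <;> rcases hL.eq_or_eq hD' hDX' with rfl | rfl
      · exact absurd rfl hne
      · exact ⟨P, hL, h3, rfl⟩
      · exact ⟨P, hL.symm, fun h => h3 (hsymm _ _ h), by rw [union_comm D]⟩
      · exact absurd rfl hne

/-- A circuit that is not a balanced cycle contains two cycles, and any two of its cycles determine
it up to a linking path. Nested circuits of this kind share such a pair, and whether a path is
needed depends only on the pair. -/
lemma eq_of_subset_of_mem_pairCircuits (h𝓑 : G.IsBiased 𝓑) (hsymm : ∀ C D, Dep C D → Dep D C)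
    (hX : X ∈ G.pairCircuits 𝓑 Dep) (hY : Y ∈ G.pairCircuits 𝓑 Dep) (hYX : Y ⊆ X) : Y = X := by
  by_cases hX𝓑 : X ∈ 𝓑
  · obtain ⟨C, hC, hCY⟩ : ∃ C, G.IsCycle C ∧ C ⊆ Y := by
      by_cases hY𝓑 : Y ∈ 𝓑
      · exact ⟨Y, h𝓑.isCycle Y hY𝓑, subset_rfl⟩
      · obtain ⟨-, ⟨C, -, hC, -, -, hCY, -⟩, -⟩ := cycles_of_mem_pairCircuits hsymm hY hY𝓑
        exact ⟨C, hC, hCY⟩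
    have := (h𝓑.isCycle X hX𝓑).eq_of_subset hC (hCY.trans hYX)
    exact subset_antisymm hYX (this ▸ hCY)
  · obtain ⟨h1, -, h3⟩ := cycles_of_mem_pairCircuits hsymm hX hX𝓑
    have hY𝓑 : Y ∉ 𝓑 := fun h => h1 Y (h𝓑.isCycle Y h) hYX h
    obtain ⟨-, ⟨C, D, hC, hD, hne, hCY, hDY⟩, h3'⟩ := cycles_of_mem_pairCircuits hsymm hY hY𝓑
    rcases h3 C D hC hD hne (hCY.trans hYX) (hDY.trans hYX) with ⟨rfl, -⟩ | ⟨P, hL, hdep, rfl⟩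
    · exact subset_antisymm hYX (union_subset hCY hDY)
    · rcases h3' C D hC hD hne hCY hDY with ⟨-, h | h⟩ | ⟨Q, hL', -, rfl⟩
      · exact absurd h hdep
      · exact absurd hL.2.2.1 h
      · rw [hL.eq_of_subset hL' (subset_union_right.trans hYX)]

lemma finite_of_mem_pairCircuits (h𝓑 : G.IsBiased 𝓑) (hX : X ∈ G.pairCircuits 𝓑 Dep) :
    X.Finite := by
  rcases hX with hX | ⟨P, Q, R, hT, -, -, -, rfl⟩ | ⟨C, C', ⟨hC, hC', -⟩, -, -, rfl⟩ |
    ⟨C, C', hC, hC', -, -, -, -, rfl⟩ | ⟨C, C', P, hL, -, -, -, rfl⟩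
  · exact (h𝓑.isCycle X hX).finite
  · exact hT.isCycle.finite.union (hT.rotate.rotate.isCycle.finite.subset subset_union_left)
  · exact hC.finite.union hC'.finite
  · exact hC.finite.union hC'.finite
  · obtain ⟨x, y, -, hP, -⟩ := hL.exists_isPath
    exact (hL.1.finite.union hL.2.1.finite).union hP.finite

lemma subset_edgeSet_of_mem_pairCircuits (h𝓑 : G.IsBiased 𝓑) (hX : X ∈ G.pairCircuits 𝓑 Dep) :
    X ⊆ G.edgeSet := by
  rcases hX with hX | ⟨P, Q, R, hT, -, -, -, rfl⟩ | ⟨C, C', ⟨hC, hC', -⟩, -, -, rfl⟩ |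
    ⟨C, C', hC, hC', -, -, -, -, rfl⟩ | ⟨C, C', P, hL, -, -, -, rfl⟩
  · exact (h𝓑.isCycle X hX).subset_edgeSet
  · exact union_subset hT.isCycle.subset_edgeSet
      (subset_union_left.trans hT.rotate.rotate.isCycle.subset_edgeSet)
  · exact union_subset hC.subset_edgeSet hC'.subset_edgeSet
  · exact union_subset hC.subset_edgeSet hC'.subset_edgeSet
  · obtain ⟨x, y, -, hP, -⟩ := hL.exists_isPath
    exact union_subset (union_subset hL.1.subset_edgeSet hL.2.1.subset_edgeSet) hP.subset_edgeSet

/-! ### Counting the acyclic components -/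

/-- The component of `x` in `X` contains no cycle. -/
def AcyclicAt (G : Graph V E) (X : Set E) (x : V) : Prop :=
  ∀ C, G.IsCycle C → C ⊆ X → ∀ a ∈ G.vertsOf C, ¬ G.Conn X x a

lemma AcyclicAt.mono (h : G.AcyclicAt X x) (hYX : Y ⊆ X) : G.AcyclicAt Y x :=
  fun C hC hCY a ha hxa => h C hC (hCY.trans hYX) a ha (hxa.mono hYX)

lemma AcyclicAt.of_conn (h : G.AcyclicAt X x) (hxy : G.Conn X x y) : G.AcyclicAt X y :=
  fun C hC hCX a ha hya => h C hC hCX a ha (hxy.trans hya)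

/-- `R` contains exactly one vertex of each acyclic component of `X` in `W`,
and no other vertices. -/
structure IsRootSet (G : Graph V E) (W : Set V) (X : Set E) (R : Set V) : Prop where
  subset : R ⊆ W
  acyclic : ∀ r ∈ R, G.AcyclicAt X r
  exists_root : ∀ x ∈ W, G.AcyclicAt X x → ∃ r ∈ R, G.Conn X x r
  eq_of_conn : ∀ r ∈ R, ∀ s ∈ R, G.Conn X r s → r = s

lemma IsCycle.conn_of_mem_insert (hC : G.IsCycle C) (hCX : C ⊆ insert e X) (he : e ∈ C)
    (hl : G.IsLink e x y) : G.Conn X x y :=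
  (hC.conn_diff he hl).mono fun _ hf => (hCX hf.1).resolve_left hf.2

/-- An edge inside an acyclic component creates a cycle there, so that component gives up its root
and the others keep theirs. -/
lemma IsRootSet.insert_of_conn {W A : Set V} (h : G.IsRootSet W X A) (hl : G.IsLink e x y)
    (he : e ∉ X) (hxy : G.Conn X x y) (ha : a ∈ A) (hxa : G.Conn X x a) :
    G.IsRootSet W (insert e X) (A \ {a}) where
  subset := sdiff_subset.trans h.subset
  acyclic r hr C hC hCX b hb hrb := by
    have hrb := hrb.of_insert_of_conn hl hxy
    by_cases heC : e ∈ C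
    · have hb' : G.Conn X b x :=
        ((hC.conn hb ⟨e, heC, hl.inc_left⟩).mono hCX).of_insert_of_conn hl hxy
      exact hr.2 (h.eq_of_conn r hr.1 a ha (hrb.trans (hb'.trans hxa)))
    · exact h.acyclic r hr.1 C hC (fun f hf => (hCX hf).resolve_left fun h => heC (h ▸ hf)) b hb hrb
  exists_root z hz hzX := by
    obtain ⟨r, hr, hzr⟩ := h.exists_root z hz (hzX.mono (subset_insert _ _))
    refine ⟨r, ⟨hr, fun hra => ?_⟩, hzr.mono (subset_insert _ _)⟩
    rw [mem_singleton_iff] at hra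
    subst hra
    obtain ⟨C, hC, heC, hCX⟩ := hxy.exists_isCycle hl he
    exact hzX C hC hCX x ⟨e, heC, hl.inc_left⟩ ((hzr.trans hxa.symm).mono (subset_insert _ _))
  eq_of_conn r hr s hs hrs := h.eq_of_conn r hr.1 s hs.1 (hrs.of_insert_of_conn hl hxy)

/-- The acyclic component of `x` merges into that of `y`, which supplies the root if it has one; if
it has none, the merged component contains a cycle and needs none. In both cases only the root `a`
goes. -/
lemma IsRootSet.insert_of_not_conn {W A : Set V} (h : G.IsRootSet W X A) (hl : G.IsLink e x y)
    (hxy : ¬ G.Conn X x y) (hyW : y ∈ W) (hx : G.AcyclicAt X x) (ha : a ∈ A)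
    (hxa : G.Conn X x a) : G.IsRootSet W (insert e X) (A \ {a}) where
  subset := sdiff_subset.trans h.subset
  acyclic r hr C hC hCX b hb hrb := by
    have heC : e ∉ C := fun heC => hxy (hC.conn_of_mem_insert hCX heC hl)
    have hCX : C ⊆ X := fun f hf => (hCX hf).resolve_left fun h => heC (h ▸ hf)
    rcases hrb.of_insert hl with hrb | ⟨hrx, -⟩ | ⟨-, hxb⟩
    · exact h.acyclic r hr.1 C hC hCX b hb hrb
    · exact hr.2 (h.eq_of_conn r hr.1 a ha (hrx.trans hxa))
    · exact hx C hC hCX b hb hxb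
  exists_root z hz hzX := by
    have hmono : ∀ {a b}, G.Conn X a b → G.Conn (insert e X) a b :=
      fun h => h.mono (subset_insert _ _)
    obtain ⟨r, hr, hzr⟩ := h.exists_root z hz (hzX.mono (subset_insert _ _))
    by_cases hra : r = a
    · subst hra
      have hzy : G.Conn (insert e X) z y :=
        (hmono (hzr.trans hxa.symm)).trans (Conn.of_isLink hl (mem_insert _ _))
      obtain ⟨s, hs, hys⟩ := h.exists_root y hyW ((hzX.of_conn hzy).mono (subset_insert _ _))
      refine ⟨s, ⟨hs, fun hsr => hxy ?_⟩, hzy.trans (hmono hys)⟩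
      rw [mem_singleton_iff] at hsr
      exact hxa.trans (hsr ▸ hys.symm)
    · exact ⟨r, ⟨hr, hra⟩, hmono hzr⟩
  eq_of_conn r hr s hs hrs := by
    rcases hrs.of_insert hl with hrs | ⟨hrx, -⟩ | ⟨-, hxs⟩
    · exact h.eq_of_conn r hr.1 s hs.1 hrs
    · exact absurd (h.eq_of_conn r hr.1 a ha (hrx.trans hxa)) hr.2
    · exact absurd (h.eq_of_conn s hs.1 a ha (hxs.symm.trans hxa)) hs.2

/-- If no component of `X` contains two cycles, then the number of edges of `X` and the number of
its acyclic components add up to the number of vertices. -/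
lemma SeparatesCycles.exists_isRootSet {W : Set V} (hW : W.Finite) (hX : X.Finite)
    (hXE : X ⊆ G.edgeSet) (hXW : G.vertsOf X ⊆ W) (h : G.SeparatesCycles X) :
    ∃ A, G.IsRootSet W X A ∧ X.ncard + A.ncard = W.ncard := by
  induction X, hX using Set.Finite.induction_on with
  | empty =>
    refine ⟨W, ⟨subset_rfl, ?_, fun x hx _ => ⟨x, hx, Conn.refl _ _ _⟩, ?_⟩, by simp⟩
    · intro r _ C hC hC0
      exact absurd (subset_empty_iff.1 hC0) hC.nonempty.ne_empty
    · intro r _ s _ hrs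
      rcases Relation.ReflTransGen.cases_head hrs with h | ⟨_, ⟨e, he, -⟩, -⟩
      · exact h
      · exact absurd he (notMem_empty e)
  | @insert e X he hX ih =>
    have hmono : ∀ {a b}, G.Conn X a b → G.Conn (insert e X) a b :=
      fun h => h.mono (subset_insert _ _)
    obtain ⟨A, hA, hcard⟩ := ih ((subset_insert _ _).trans hXE)
      ((vertsOf_mono (subset_insert _ _)).trans hXW) (h.mono (subset_insert _ _))
    obtain ⟨x, y, hl⟩ := exists_isLink_of_mem_edgeSet (hXE (mem_insert e X))
    have hxW : x ∈ W := hXW ⟨e, mem_insert _ _, hl.inc_left⟩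
    have hyW : y ∈ W := hXW ⟨e, mem_insert _ _, hl.inc_right⟩
    have hfin : A.Finite := hW.subset hA.subset
    suffices hs : ∃ a ∈ A, G.IsRootSet W (insert e X) (A \ {a}) by
      obtain ⟨a, ha, hs⟩ := hs
      refine ⟨_, hs, ?_⟩
      have := ncard_sdiff_singleton_add_one ha hfin
      rw [ncard_insert_of_notMem he hX]
      omega
    -- Either `e` closes a cycle, so its component had none before, or it joins two components, of
    -- which at most one had a cycle. In both cases exactly one root is lost.
    by_cases hxy : G.Conn X x y
    · obtain ⟨C, hC, heC, hCX⟩ := hxy.exists_isCycle hl he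
      have hx : G.AcyclicAt X x := fun D hD hDX b hb hxb =>
        h C D hC hD hCX (hDX.trans (subset_insert _ _)) (fun hCD => he (hDX (hCD ▸ heC)))
          x ⟨e, heC, hl.inc_left⟩ b hb (hmono hxb)
      obtain ⟨a, ha, hxa⟩ := hA.exists_root x hxW hx
      exact ⟨a, ha, hA.insert_of_conn hl he hxy ha hxa⟩
    · have hor : G.AcyclicAt X x ∨ G.AcyclicAt X y := by
        by_contra! hcon
        simp only [AcyclicAt, not_forall, not_not] at hcon
        obtain ⟨⟨C, hC, hCX, c, hc, hxc⟩, ⟨D, hD, hDX, d, hd, hyd⟩⟩ := hcon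
        refine h C D hC hD (hCX.trans (subset_insert _ _)) (hDX.trans (subset_insert _ _)) ?_
          c hc d hd ((hmono hxc.symm).trans
            ((Conn.of_isLink hl (mem_insert _ _)).trans (hmono hyd)))
        rintro rfl
        exact hxy (hxc.trans (((hC.conn hc hd).mono hCX).trans hyd.symm))
      rcases hor with hx | hy
      · obtain ⟨a, ha, hxa⟩ := hA.exists_root x hxW hx
        exact ⟨a, ha, hA.insert_of_not_conn hl hxy hyW hx ha hxa⟩
      · obtain ⟨a, ha, hya⟩ := hA.exists_root y hyW hy
        exact ⟨a, ha, hA.insert_of_not_conn hl.symm (fun h => hxy h.symm) hxW hy ha hya⟩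

/-! ### Augmentation -/

/-- `Dep` is a symmetric relation such that replacing one cycle of a pair of vertex-disjoint
unbalanced cycles does not change whether they are related. -/
structure IsProperRel (G : Graph V E) (𝓑 : Set (Set E)) (Dep : Set E → Set E → Prop) : Prop where
  symm : ∀ C D, Dep C D → Dep D C
  congr : ∀ C D F, G.IsCycle C → G.IsCycle D → G.IsCycle F → C ∉ 𝓑 → D ∉ 𝓑 → F ∉ 𝓑 →
    Disjoint (G.vertsOf C) (G.vertsOf F) → Disjoint (G.vertsOf D) (G.vertsOf F) →
    Dep C F → Dep D F

/-- If an unbalanced cycle lies in an acyclic component of `I`, then some edge of it forms an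
unbalanced cycle with edges of `I`. -/
lemma exists_unbalanced_insert (h𝓑 : G.IsBiased 𝓑) (hr : G.AcyclicAt I r) (hD : G.IsCycle D)
    (hD𝓑 : D ∉ 𝓑) (hrD : ∀ a ∈ G.vertsOf D, G.Conn I r a) :
    ∃ e ∈ D, e ∉ I ∧ ∃ C, G.IsCycle C ∧ C ∉ 𝓑 ∧ e ∈ C ∧ C ⊆ insert e I := by
  induction hn : (D \ I).ncard using Nat.strong_induction_on generalizing D with
  | _ n ih =>
  subst hn
  obtain ⟨d, hd⟩ := hD.vertsOf_nonempty
  have hnot : ∀ {C}, G.IsCycle C → (∀ a ∈ G.vertsOf C, G.Conn I r a) → ¬ C ⊆ I := by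
    intro C hC hrC hCI
    obtain ⟨c, hc⟩ := hC.vertsOf_nonempty
    exact hr C hC hCI c hc (hrC c hc)
  obtain ⟨e, heD, heI⟩ := Set.not_subset.1 (hnot hD hrD)
  by_cases hone : D ⊆ insert e I
  · exact ⟨e, heD, heI, D, hD, hD𝓑, heD, hone⟩
  · obtain ⟨f, hfD, hf⟩ := Set.not_subset.1 hone
    obtain ⟨x, y, hl⟩ := exists_isLink_of_mem_edgeSet (hD.subset_edgeSet heD)
    have hxD : x ∈ G.vertsOf D := ⟨e, heD, hl.inc_left⟩
    have hyD : y ∈ G.vertsOf D := ⟨e, heD, hl.inc_right⟩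
    -- Otherwise `e` would close a cycle within `D`, hence equal to `D`, using only `e` and edges of
    -- `I`.
    have hnc : ¬ G.Conn (I ∩ D) x y := by
      intro hc
      obtain ⟨C, hC, -, hCX⟩ := hc.exists_isCycle hl fun h => heI h.1
      have hCD := hD.eq_of_subset hC (hCX.trans (insert_subset heD inter_subset_right))
      rcases hCX (hCD ▸ hfD) with rfl | h
      · exact hf (mem_insert _ _)
      · exact hf (mem_insert_of_mem _ h.1)
    obtain ⟨P, Q, R, hT, hP, rfl⟩ := hD.exists_isTheta hxD hyD
      ((hrD x hxD).symm.trans (hrD y hyD)) hnc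
    have hPI : P ⊆ I := hP.trans sdiff_subset
    have hconn : ∀ Q', Q' ⊆ Q ∪ R → Q'.Nonempty → G.IsCycle (P ∪ Q') →
        ∀ a ∈ G.vertsOf (P ∪ Q'), G.Conn I r a := by
      intro Q' hQ' hne hC a ha
      obtain ⟨c, hc⟩ := vertsOf_nonempty (hQ'.trans hD.subset_edgeSet) hne
      rw [vertsOf_union] at ha
      rcases ha with ha | ha
      · obtain ⟨u, v, huv, hPp, -, -, -, -, -, h4, -, -⟩ := hT
        have hu : u ∈ G.vertsOf (Q ∪ R) := by
          rw [vertsOf_union]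
          exact Or.inl (h4.symm.subset (Or.inl rfl)).2
        refine (hrD u hu).trans (Conn.mono ?_ hPI)
        exact hPp.conn_of_mem huv ha
      · exact hrD a (vertsOf_mono hQ' ha)
    have hQc := hT.isCycle
    have hRc := hT.swap_right.isCycle
    -- Since `P` lies in `I` but the cycle `P ∪ R'` does not, `R'` has an edge outside `I`;
    -- rerouting along `P` discards it.
    have hlt : ∀ Q' R', Q' ∪ R' = Q ∪ R → Disjoint Q' R' → ¬ P ∪ R' ⊆ I →
        ((P ∪ Q') \ I).ncard < ((Q ∪ R) \ I).ncard := by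
      intro Q' R' hQR hd hR'
      apply ncard_lt_ncard _ (hD.finite.subset sdiff_subset)
      rw [← hQR]
      refine ⟨?_, fun hsub => ?_⟩
      · rintro g ⟨hg | hg, hgI⟩
        · exact absurd (hPI hg) hgI
        · exact ⟨Or.inl hg, hgI⟩
      · obtain ⟨g, hg, hgI⟩ := Set.not_subset.1 hR'
        have hgR := hg.resolve_left fun h => hgI (hPI h)
        rcases (hsub ⟨Or.inr hgR, hgI⟩).1 with h | h
        · exact hgI (hPI h)
        · exact Set.disjoint_left.1 hd h hgR
    have hrQ := hconn Q subset_union_left hT.swap_left.nonempty hQc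
    have hrR := hconn R subset_union_right hT.rotate.rotate.nonempty hRc
    -- The theta property makes one of the two rerouted cycles unbalanced.
    by_cases hb : P ∪ Q ∈ 𝓑
    · have hb' : P ∪ R ∉ 𝓑 := fun hb' => hD𝓑 (h𝓑.theta P Q R hT hb hb')
      obtain ⟨g, hg, hgI, hC⟩ := ih _ (hlt R Q (union_comm _ _) hT.rotate.disjoint.symm
        (hnot hQc hrQ)) hRc hb' hrR rfl
      exact ⟨g, Or.inr (hg.resolve_left fun h => hgI (hPI h)), hgI, hC⟩
    · obtain ⟨g, hg, hgI, hC⟩ := ih _ (hlt Q R rfl hT.rotate.disjoint (hnot hRc hrR)) hQc hb hrQ rfl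
      exact ⟨g, Or.inl (hg.resolve_left fun h => hgI (hPI h)), hgI, hC⟩

/-- Here `e` is a bridge, so no cycle is created, and the merged component has no cycle on the side
of `x`. -/
lemma PairIndep.insert_of_not_conn (hI : G.PairIndep 𝓑 Dep I) (hl : G.IsLink e x y)
    (hx : G.AcyclicAt I x) (hxy : ¬ G.Conn I x y) : G.PairIndep 𝓑 Dep (insert e I) := by
  have hsub : ∀ C, G.IsCycle C → C ⊆ insert e I → C ⊆ I := fun C hC hCI f hf =>
    (hCI hf).resolve_left fun h => hxy (hC.conn_of_mem_insert hCI (h ▸ hf) hl)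
  refine ⟨insert_subset hl.edge_mem hI.subset_edgeSet, fun C hC hCI => hI.notMem C hC (hsub C hC hCI),
    ?_, fun C D hC hD hCI hDI => hI.not_dep C D hC hD (hsub C hC hCI) (hsub D hD hDI)⟩
  intro C D hC hD hCI hDI hne a ha b hb hab
  have hCI := hsub C hC hCI
  have hDI := hsub D hD hDI
  rcases hab.of_insert hl with h | ⟨h, -⟩ | ⟨-, h⟩
  · exact hI.separates C D hC hD hCI hDI hne a ha b hb h
  · exact hx C hC hCI a ha h.symm
  · exact hx D hD hDI b hb h

/-- `C` is the only new cycle: eliminating `e` from two cycles through it would leave a cycle in the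
component of `x` in `I`, which is acyclic. Thus only dependence of `C` on a cycle of `I` could be an
obstruction. -/
lemma PairIndep.insert_of_conn (hDep : G.IsProperRel 𝓑 Dep) (hI : G.PairIndep 𝓑 Dep I)
    (hx : G.AcyclicAt I x) (hl : G.IsLink e x y)
    (hC : G.IsCycle C) (hC𝓑 : C ∉ 𝓑) (heC : e ∈ C) (hCI : C ⊆ insert e I)
    (hdep : ∀ D, G.IsCycle D → D ⊆ I → ¬ Dep C D) : G.PairIndep 𝓑 Dep (insert e I) := by
  have hxy : G.Conn I x y := hC.conn_of_mem_insert hCI heC hl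
  have hxC : ∀ a ∈ G.vertsOf C, G.Conn I x a := fun a ha =>
    ((hC.conn ⟨e, heC, hl.inc_left⟩ ha).mono hCI).of_insert_of_conn hl hxy
  have hor : ∀ D, G.IsCycle D → D ⊆ insert e I → D = C ∨ D ⊆ I := by
    intro D hD hDI
    by_cases heD : e ∈ D
    · left
      by_contra hne
      obtain ⟨F, hF, hFCD⟩ := hD.exists_isCycle_diff hC hne heD heC
      have hFI : F ⊆ I := fun f hf => by
        rcases hFCD hf with ⟨h | h, h'⟩
        · exact (hDI h).resolve_left h'
        · exact (hCI h).resolve_left h'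
      obtain ⟨c, hc⟩ := hF.vertsOf_nonempty
      have hc' : c ∈ G.vertsOf (D ∪ C) := vertsOf_mono (hFCD.trans sdiff_subset) hc
      refine hx F hF hFI c hc ?_
      rw [vertsOf_union] at hc'
      rcases hc' with h | h
      · exact ((hD.conn ⟨e, heD, hl.inc_left⟩ h).mono hDI).of_insert_of_conn hl hxy
      · exact hxC c h
    · exact Or.inr fun f hf => (hDI hf).resolve_left fun h => heD (h ▸ hf)
  refine ⟨insert_subset hl.edge_mem hI.subset_edgeSet, ?_, ?_, ?_⟩
  · intro D hD hDI
    rcases hor D hD hDI with rfl | hDI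
    · exact hC𝓑
    · exact hI.notMem D hD hDI
  · intro D D' hD hD' hDI hDI' hne a ha b hb hab
    have hab := hab.of_insert_of_conn hl hxy
    rcases hor D hD hDI with rfl | hDI <;> rcases hor D' hD' hDI' with rfl | hDI'
    · exact hne rfl
    · exact hx D' hD' hDI' b hb ((hxC a ha).trans hab)
    · exact hx D hD hDI a ha ((hxC b hb).trans hab.symm)
    · exact hI.separates D D' hD hD' hDI hDI' hne a ha b hb hab
  · intro D D' hD hD' hDI hDI' hne hdd
    rcases hor D hD hDI with rfl | hDI <;> rcases hor D' hD' hDI' with rfl | hDI'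
    · exact hne rfl
    · exact hdep D' hD' hDI' hdd
    · exact hdep D hD hDI (hDep.symm _ _ hdd)
    · exact hI.not_dep D D' hD hD' hDI hDI' hne hdd

/-- Sending each vertex of `A` to the root of its component is injective. -/
lemma IsRootSet.ncard_le {W A B : Set V} (h : G.IsRootSet W X B) (hW : W.Finite) (hA : A ⊆ W)
    (hac : ∀ a ∈ A, G.AcyclicAt X a) (hinj : ∀ a ∈ A, ∀ b ∈ A, G.Conn X a b → a = b) :
    A.ncard ≤ B.ncard := by
  have hex : ∀ a, ∃ b, a ∈ A → b ∈ B ∧ G.Conn X a b := by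
    intro a
    by_cases ha : a ∈ A
    · obtain ⟨b, hb, hab⟩ := h.exists_root a (hA ha) (hac a ha)
      exact ⟨b, fun _ => ⟨hb, hab⟩⟩
    · exact ⟨a, fun h => absurd h ha⟩
  choose f hf using hex
  refine ncard_le_ncard_of_injOn f (fun a ha => (hf a ha).1) ?_ (hW.subset h.subset)
  intro a ha b hb hab
  exact hinj a ha b hb ((hf a ha).2.trans (hab ▸ (hf b hb).2.symm))

theorem PairIndep.exists_insert (h𝓑 : G.IsBiased 𝓑) (hDep : G.IsProperRel 𝓑 Dep)
    (hI : G.PairIndep 𝓑 Dep I) (hIf : I.Finite) (hJ : G.PairIndep 𝓑 Dep J) (hJf : J.Finite)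
    (hlt : I.ncard < J.ncard) : ∃ e ∈ J, e ∉ I ∧ G.PairIndep 𝓑 Dep (insert e I) := by
  by_contra! hcon
  have hW : (G.vertsOf (I ∪ J)).Finite := vertsOf_finite (hIf.union hJf)
  have hJW : G.vertsOf J ⊆ G.vertsOf (I ∪ J) := vertsOf_mono subset_union_right
  have hIW : G.vertsOf I ⊆ G.vertsOf (I ∪ J) := vertsOf_mono subset_union_left
  obtain ⟨A, hA, hAcard⟩ := hI.separates.exists_isRootSet hW hIf hI.subset_edgeSet hIW
  obtain ⟨B, hB, hBcard⟩ := hJ.separates.exists_isRootSet hW hJf hJ.subset_edgeSet hJW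
  have hclosed : ∀ r, G.AcyclicAt I r → ∀ e ∈ J, ∀ a b, G.IsLink e a b → G.Conn I r a →
      G.Conn I r b := by
    intro r hr e he a b hl hra
    by_contra hrb
    have hab : ¬ G.Conn I a b := fun h => hrb (hra.trans h)
    exact hcon e he (fun heI => hab (Conn.of_isLink hl heI))
      (hI.insert_of_not_conn hl (hr.of_conn hra) hab)
  -- Otherwise the roots of `I` would lie in distinct acyclic components of `J`, whereas `|I| < |J|`
  -- forces `|B| < |A|`.
  obtain ⟨r, hrA, hrJ⟩ : ∃ r ∈ A, ¬ G.AcyclicAt J r := by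
    by_contra! h
    have := hB.ncard_le hW hA.subset h fun a ha b hb hab =>
      hA.eq_of_conn a ha b hb (hab.of_closed (hclosed a (hA.acyclic a ha)))
    omega
  have hrI := hA.acyclic r hrA
  simp only [AcyclicAt, not_forall, not_not] at hrJ
  obtain ⟨D, hD, hDJ, d, hd, hrd⟩ := hrJ
  have hrD : ∀ a ∈ G.vertsOf D, G.Conn I r a := fun a ha =>
    (hrd.trans ((hD.conn hd ha).mono hDJ)).of_closed (hclosed r hrI)
  obtain ⟨e, heD, heI, C, hC, hC𝓑, heC, hCI⟩ :=
    exists_unbalanced_insert h𝓑 hrI hD (hJ.notMem D hD hDJ) hrD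
  obtain ⟨x, y, hl⟩ := exists_isLink_of_mem_edgeSet (hD.subset_edgeSet heD)
  have hxI : G.AcyclicAt I x := hrI.of_conn (hrD x ⟨e, heD, hl.inc_left⟩)
  have hxy : G.Conn I x y := hC.conn_of_mem_insert hCI heC hl
  have hxC : ∀ a ∈ G.vertsOf C, G.Conn I x a := fun a ha =>
    ((hC.conn ⟨e, heC, hl.inc_left⟩ ha).mono hCI).of_insert_of_conn hl hxy
  obtain ⟨C₁, hC₁, hC₁I, hdep⟩ : ∃ C₁, G.IsCycle C₁ ∧ C₁ ⊆ I ∧ Dep C C₁ := by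
    by_contra! h
    exact hcon e (hDJ heD) heI (hI.insert_of_conn hDep hxI hl hC hC𝓑 heC hCI h)
  have hC₁𝓑 := hI.notMem C₁ hC₁ hC₁I
  have hCC₁ : Disjoint (G.vertsOf C) (G.vertsOf C₁) := Set.disjoint_left.2 fun a ha ha' =>
    hxI C₁ hC₁ hC₁I a ha' (hxC a ha)
  -- Another cycle `C₂` of `I` could replace `C` in `Dep C C₁`, making two cycles of `I` dependent.
  have huniq : ∀ C₂, G.IsCycle C₂ → C₂ ⊆ I → C₂ = C₁ := by
    intro C₂ hC₂ hC₂I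
    by_contra hne
    exact hI.not_dep C₂ C₁ hC₂ hC₁ hC₂I hC₁I hne (hDep.congr C C₂ C₁ hC hC₂ hC₁ hC𝓑
      (hI.notMem C₂ hC₂ hC₂I) hC₁𝓑 hCC₁ (hI.separates.disjoint hC₂ hC₁ hC₂I hC₁I hne) hdep)
  obtain ⟨k, hk⟩ := hC₁.vertsOf_nonempty
  have hkA : ∀ a, G.AcyclicAt I a → ¬ G.Conn I a k := fun a ha hak => ha C₁ hC₁ hC₁I k hk hak
  -- An edge leaving the component of `C₁` would enter an acyclic component, as `C₁` is the only
  -- cycle of `I`, and edges of `J` do not cross the boundary of those.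
  have hkclosed : ∀ e ∈ J, ∀ a b, G.IsLink e a b → G.Conn I k a → G.Conn I k b := by
    intro e he a b hl hka
    by_contra hkb
    have hb : G.AcyclicAt I b := by
      intro C₂ hC₂ hC₂I c hc hbc
      obtain rfl := huniq C₂ hC₂ hC₂I
      exact hkb (((hC₂.conn hk hc).mono hC₂I).trans hbc.symm)
    exact hkb (hka.trans (hclosed b hb e he b a hl.symm (Conn.refl _ _ _)).symm)
  have hkS : k ∉ A := fun h => hkA k (hA.acyclic k h) (Conn.refl _ _ _)
  have hAfin : A.Finite := hW.subset hA.subset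
  have hSconn : ∀ s ∈ insert k A, ∀ a, G.Conn J s a → G.Conn I s a := by
    rintro s (rfl | hs) a hsa
    · exact hsa.of_closed hkclosed
    · exact hsa.of_closed (hclosed s (hA.acyclic s hs))
  have hSinj : ∀ s ∈ insert k A, ∀ t ∈ insert k A, G.Conn J s t → s = t := by
    intro s hs t ht hst
    have hst := hSconn s hs t hst
    rcases hs with rfl | hs <;> rcases ht with rfl | ht
    · rfl
    · exact absurd hst.symm (hkA t (hA.acyclic t ht))
    · exact absurd hst (hkA s (hA.acyclic s hs))
    · exact hA.eq_of_conn s hs t ht hst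
  -- The vertices of `insert k A` lie in distinct components of `J`. There are at least `|B| + 2` of
  -- them and at most `|B|` are in acyclic components of `J`, which leaves two whose components
  -- contain cycles.
  obtain ⟨s, ⟨hs, hsJ⟩, t, ⟨ht, htJ⟩, hst⟩ :
      ∃ s ∈ {s ∈ insert k A | ¬ G.AcyclicAt J s}, ∃ t ∈ {s ∈ insert k A | ¬ G.AcyclicAt J s},
        s ≠ t := by
    have h1 := hB.ncard_le (A := {s ∈ insert k A | G.AcyclicAt J s}) hW
      (fun s hs => insert_subset (hIW (vertsOf_mono hC₁I hk)) hA.subset hs.1) (fun s hs => hs.2)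
      fun s hs t ht => hSinj s hs.1 t ht.1
    have h2 : (insert k A).ncard ≤ {s ∈ insert k A | G.AcyclicAt J s}.ncard +
        {s ∈ insert k A | ¬ G.AcyclicAt J s}.ncard := by
      refine (ncard_le_ncard ?_ ((hAfin.insert k).subset ?_)).trans (ncard_union_le _ _)
      · intro s hs
        by_cases h : G.AcyclicAt J s
        · exact Or.inl ⟨hs, h⟩
        · exact Or.inr ⟨hs, h⟩
      · exact union_subset (sep_subset _ _) (sep_subset _ _)
    rw [ncard_insert_of_notMem hkS hAfin] at h2
    have h3 : 1 < {s ∈ insert k A | ¬ G.AcyclicAt J s}.ncard := by omega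
    rwa [one_lt_ncard ((hAfin.insert k).subset (sep_subset _ _))] at h3
  simp only [AcyclicAt, not_forall, not_not] at hsJ htJ
  obtain ⟨D₁, hD₁, hD₁J, d₁, hd₁, hsd₁⟩ := hsJ
  obtain ⟨D₂, hD₂, hD₂J, d₂, hd₂, htd₂⟩ := htJ
  have hdisj : Disjoint (G.vertsOf D₂) (G.vertsOf D₁) := Set.disjoint_left.2 fun a ha₂ ha₁ =>
    hst <| hSinj s hs t ht <| (hsd₁.trans ((hD₁.conn hd₁ ha₁).mono hD₁J)).trans
      (htd₂.trans ((hD₂.conn hd₂ ha₂).mono hD₂J)).symm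
  have hD₁𝓑 := hJ.notMem D₁ hD₁ hD₁J
  have hD₂𝓑 := hJ.notMem D₂ hD₂ hD₂J
  have hsD₁ : ∀ a ∈ G.vertsOf D₁, G.Conn I s a := fun a ha =>
    hSconn s hs a (hsd₁.trans ((hD₁.conn hd₁ ha).mono hD₁J))
  apply hJ.not_dep D₂ D₁ hD₂ hD₁ hD₂J hD₁J (hD₂.ne_of_disjoint hdisj)
  -- `D₁` stays in one component of `I`, so it is disjoint from `C` or from `C₁`. It replaces the
  -- cycle of the other component in the dependent pair, and then `D₂` replaces the remaining one;
  -- `D₂` has to be disjoint only from `D₁`.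
  by_cases hsk : G.Conn I s k
  · have hd : Disjoint (G.vertsOf D₁) (G.vertsOf C) := Set.disjoint_left.2 fun a ha ha' =>
      hkA x hxI ((hxC a ha').trans ((hsD₁ a ha).symm.trans hsk))
    exact hDep.congr C D₂ D₁ hC hD₂ hD₁ hC𝓑 hD₂𝓑 hD₁𝓑 hd.symm hdisj (hDep.symm _ _
      (hDep.congr C₁ D₁ C hC₁ hD₁ hC hC₁𝓑 hD₁𝓑 hC𝓑 hCC₁.symm hd (hDep.symm _ _ hdep)))
  · have hd : Disjoint (G.vertsOf D₁) (G.vertsOf C₁) := Set.disjoint_left.2 fun a ha ha' =>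
      hsk ((hsD₁ a ha).trans ((hC₁.conn ha' hk).mono hC₁I))
    exact hDep.congr C₁ D₂ D₁ hC₁ hD₂ hD₁ hC₁𝓑 hD₂𝓑 hD₁𝓑 hd.symm hdisj (hDep.symm _ _
      (hDep.congr C D₁ C₁ hC hD₁ hC₁ hC𝓑 hD₁𝓑 hC₁𝓑 hCC₁ hd hdep))

/-! ### The matroid -/

theorem isCircuitSetOfMatroid_pairCircuits (h𝓑 : G.IsBiased 𝓑) (hDep : G.IsProperRel 𝓑 Dep) :
    G.IsCircuitSetOfMatroid (G.pairCircuits 𝓑 Dep) := by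
  have hne : ∀ X ∈ G.pairCircuits 𝓑 Dep, X.Nonempty := by
    intro X hX
    by_cases hX𝓑 : X ∈ 𝓑
    · exact (h𝓑.isCycle X hX𝓑).nonempty
    · obtain ⟨-, ⟨C, -, hC, -, -, hCX, -⟩, -⟩ := cycles_of_mem_pairCircuits hDep.symm hX hX𝓑
      exact hC.nonempty.mono hCX
  let M := IndepMatroid.ofFinitaryCardAugment G.edgeSet (G.PairIndep 𝓑 Dep)
    (by
      refine (pairIndep_iff h𝓑).2 ⟨empty_subset _, fun X hX hX0 => ?_⟩
      exact (hne X hX).ne_empty (subset_empty_iff.1 hX0))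
    (fun I J hJ hIJ => hJ.mono hIJ)
    (fun I J hI hIf hJ hJf hlt => hI.exists_insert h𝓑 hDep hIf hJ hJf hlt)
    -- Compactness: a circuit contained in `I` is a finite subset of `I`.
    (fun I hI => by
      refine (pairIndep_iff h𝓑).2 ⟨fun e he => ?_, fun X hX hXI => ?_⟩
      · exact (hI {e} (singleton_subset_iff.2 he) (finite_singleton e)).subset_edgeSet rfl
      · exact ((pairIndep_iff h𝓑).1 (hI X hXI (finite_of_mem_pairCircuits h𝓑 hX))).2 X hX subset_rfl)
    (fun I hI => hI.subset_edgeSet)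
  have hdep : ∀ X, M.matroid.Dep X ↔ (∃ Y ∈ G.pairCircuits 𝓑 Dep, Y ⊆ X) ∧ X ⊆ G.edgeSet := by
    intro X
    change ¬ G.PairIndep 𝓑 Dep X ∧ X ⊆ G.edgeSet ↔ _
    rw [pairIndep_iff h𝓑]
    constructor
    · rintro ⟨h, hX⟩
      by_contra! hcon
      exact h ⟨hX, fun Y hY hYX => hcon ⟨Y, hY, hYX⟩ hX⟩
    · rintro ⟨⟨Y, hY, hYX⟩, hX⟩
      exact ⟨fun h => h.2 Y hY hYX, hX⟩
  refine ⟨M.matroid, rfl, ?_⟩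
  ext X
  rw [mem_ofPred_eq, Matroid.isCircuit_iff]
  constructor
  · rintro ⟨hX, hmin⟩
    obtain ⟨⟨Y, hY, hYX⟩, hXE⟩ := (hdep X).1 hX
    have := hmin ((hdep Y).2 ⟨⟨Y, hY, subset_rfl⟩, hYX.trans hXE⟩) hYX
    exact this ▸ hY
  · intro hX
    refine ⟨(hdep X).2 ⟨⟨X, hX, subset_rfl⟩, subset_edgeSet_of_mem_pairCircuits h𝓑 hX⟩, ?_⟩
    intro Y hY hYX
    obtain ⟨⟨Z, hZ, hZY⟩, -⟩ := (hdep Y).1 hY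
    have := eq_of_subset_of_mem_pairCircuits h𝓑 hDep.symm hX hZ (hZY.trans hYX)
    exact subset_antisymm hYX (this ▸ hZY)

/-! ### Bracelets -/

lemma three_le_encard {a b c : E} (ha : a ∈ X) (hb : b ∈ X) (hc : c ∈ X) (hab : a ≠ b)
    (hac : a ≠ c) (hbc : b ≠ c) : 3 ≤ X.encard := by
  rw [← encard_eq_three.2 ⟨a, b, c, hab, hac, hbc, rfl⟩]
  exact encard_le_encard (insert_subset ha (insert_subset hb (singleton_subset_iff.2 hc)))

/-- The edges `a`, `b`, `c` form a transversal of the cycles, giving the upper bound; `hge` bounds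
every transversal from below. -/
lemma cyclomaticNumber_eq_three {a b c : E} (ha : a ∈ X) (hb : b ∈ X) (hc : c ∈ X)
    (hle : ∀ D, G.IsCycle D → D ⊆ X → a ∈ D ∨ b ∈ D ∨ c ∈ D)
    (hge : ∀ F : Set E, (∀ D, G.IsCycle D → D ⊆ X → ∃ f ∈ F, f ∈ D) → 3 ≤ F.encard) :
    G.cyclomaticNumber X = 3 := by
  apply le_antisymm
  · have hmem : G.cyclomaticNumber X ≤ ({a, b, c} : Set E).encard := by
      refine sInf_le ⟨{a, b, c}, ?_, rfl, ?_⟩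
      · exact insert_subset ha (insert_subset hb (singleton_subset_iff.2 hc))
      · intro D hD hDX
        rcases hle D hD (hDX.trans sdiff_subset) with h | h | h <;> exact (hDX h).2 (by simp)
    refine hmem.trans ((encard_insert_le _ _).trans ?_)
    refine (add_le_add_left (encard_insert_le _ _) _).trans ?_
    rw [encard_singleton]
    norm_num
  · refine le_sInf ?_
    rintro _ ⟨F, -, rfl, hF⟩
    refine hge F fun D hD hDX => ?_
    by_contra! h
    exact hF D hD fun f hf => ⟨hDX hf, fun hfF => h f hfF hf⟩

lemma cyclomaticNumber_eq_three_of_isCycle (hC : G.IsCycle C) (hD : G.IsCycle D)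
    (hF : G.IsCycle F) (hne : C ≠ D) (hCD : (G.vertsOf C ∩ G.vertsOf D).Subsingleton)
    (hCF : Disjoint (G.vertsOf C) (G.vertsOf F)) (hDF : Disjoint (G.vertsOf D) (G.vertsOf F)) :
    G.cyclomaticNumber (C ∪ D ∪ F) = 3 := by
  have h1 := hC.disjoint hD hne hCD
  have h2 := hC.disjoint hF (hC.ne_of_disjoint hCF) (by rw [hCF.inter_eq]; exact subsingleton_empty)
  have h3 := hD.disjoint hF (hD.ne_of_disjoint hDF) (by rw [hDF.inter_eq]; exact subsingleton_empty)
  obtain ⟨a, ha⟩ := hC.nonempty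
  obtain ⟨b, hb⟩ := hD.nonempty
  obtain ⟨c, hc⟩ := hF.nonempty
  refine cyclomaticNumber_eq_three (Or.inl (Or.inl ha)) (Or.inl (Or.inr hb)) (Or.inr hc) ?_ ?_
  · intro Z hZ hZX
    rw [union_comm] at hZX
    rcases hF.eq_or_subset hZ hZX (by
      rw [vertsOf_union, inter_union_distrib_left, hCF.symm.inter_eq, hDF.symm.inter_eq,
        union_empty]
      exact subsingleton_empty) with rfl | hZX
    · exact Or.inr (Or.inr hc)
    · rcases hC.eq_or_eq hD hZ hCD hZX with rfl | rfl
      · exact Or.inl ha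
      · exact Or.inr (Or.inl hb)
  · intro Y hY
    obtain ⟨x, hxY, hx⟩ := hY C hC (subset_union_left.trans subset_union_left)
    obtain ⟨y, hyY, hy⟩ := hY D hD (subset_union_right.trans subset_union_left)
    obtain ⟨z, hzY, hz⟩ := hY F hF subset_union_right
    exact three_le_encard hxY hyY hzY (h1.ne_of_mem hx hy) (h2.ne_of_mem hx hz)
      (h3.ne_of_mem hy hz)

lemma cyclomaticNumber_eq_three_of_isTheta (hT : G.IsTheta P Q R) (hF : G.IsCycle F)
    (hPQ : Disjoint (G.vertsOf (P ∪ Q)) (G.vertsOf F)) (hR : Disjoint (G.vertsOf R) (G.vertsOf F)) :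
    G.cyclomaticNumber (P ∪ Q ∪ R ∪ F) = 3 := by
  obtain ⟨a, ha⟩ := hT.nonempty
  obtain ⟨b, hb⟩ := hT.swap_left.nonempty
  obtain ⟨c, hc⟩ := hF.nonempty
  have hTF : Disjoint (P ∪ Q ∪ R) F := by
    have : Disjoint (G.vertsOf (P ∪ Q ∪ R)) (G.vertsOf F) := by
      rw [vertsOf_union]
      exact hPQ.union_left hR
    refine Set.disjoint_left.2 fun f hf hfF => ?_
    obtain ⟨u, v, hl⟩ := exists_isLink_of_mem_edgeSet (hF.subset_edgeSet hfF)
    exact Set.disjoint_left.1 this ⟨f, hf, hl.inc_left⟩ ⟨f, hfF, hl.inc_left⟩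
  refine cyclomaticNumber_eq_three (Or.inl (Or.inl (Or.inl ha))) (Or.inl (Or.inl (Or.inr hb)))
    (Or.inr hc) ?_ ?_
  · intro Z hZ hZX
    rw [union_comm] at hZX
    rcases hF.eq_or_subset hZ hZX (by
      rw [vertsOf_union, inter_union_distrib_left, hPQ.symm.inter_eq, hR.symm.inter_eq,
        union_empty]
      exact subsingleton_empty) with rfl | hZX
    · exact Or.inr (Or.inr hc)
    · rcases hT.eq_of_isCycle hZ hZX with rfl | rfl | rfl
      · exact Or.inl (Or.inl ha)
      · exact Or.inl (Or.inl ha)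
      · exact Or.inr (Or.inl (Or.inl hb))
  · intro Y hY
    have hPQs : P ∪ Q ⊆ P ∪ Q ∪ R ∪ F := subset_union_left.trans subset_union_left
    have hPRs : P ∪ R ⊆ P ∪ Q ∪ R ∪ F :=
      (union_subset_union_left _ subset_union_left).trans subset_union_left
    have hQRs : Q ∪ R ⊆ P ∪ Q ∪ R ∪ F :=
      (union_subset_union_left _ subset_union_right).trans subset_union_left
    obtain ⟨z, hzY, hz⟩ := hY F hF subset_union_right
    obtain ⟨x, hxY, hx⟩ := hY _ hT.isCycle hPQs
    have hzT : ∀ {w}, w ∈ P ∪ Q ∪ R → w ≠ z := fun hw => hTF.ne_of_mem hw hz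
    -- One edge cannot meet all three cycles of a theta: the cycle formed by the two paths not
    -- containing `x` requires a second edge.
    rcases hx with hx | hx
    · obtain ⟨y, hyY, hy⟩ := hY _ hT.rotate.isCycle hQRs
      refine three_le_encard hxY hyY hzY ?_ (hzT (Or.inl (Or.inl hx))) (hzT ?_)
      · rcases hy with hy | hy
        · exact hT.disjoint.ne_of_mem hx hy
        · exact hT.swap_right.disjoint.ne_of_mem hx hy
      · rw [union_assoc]
        exact Or.inr hy
    · obtain ⟨y, hyY, hy⟩ := hY _ hT.swap_right.isCycle hPRs
      refine three_le_encard hxY hyY hzY ?_ (hzT (Or.inl (Or.inr hx))) (hzT ?_)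
      · rcases hy with hy | hy
        · exact hT.disjoint.symm.ne_of_mem hx hy
        · exact hT.rotate.disjoint.ne_of_mem hx hy
      · rcases hy with hy | hy
        · exact Or.inl (Or.inl hy)
        · exact Or.inr hy

/-- `C ∪ D` is a dependent bracelet. -/
def BraceletDep (G : Graph V E) (𝓑 : Set (Set E)) (χ : G.Bracelet 𝓑 → BraceletValue)
    (C D : Set E) : Prop :=
  ∃ h : G.IsBracelet 𝓑 (C ∪ D), χ ⟨C ∪ D, h⟩ = BraceletValue.dependent

lemma BraceletDep.symm {χ : G.Bracelet 𝓑 → BraceletValue} (h : G.BraceletDep 𝓑 χ C D) :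
    G.BraceletDep 𝓑 χ D C := by
  unfold BraceletDep at h ⊢
  rwa [union_comm D C]

lemma BraceletDep.of_cyclomaticNumber {χ : G.Bracelet 𝓑 → BraceletValue}
    (hχ : G.IsProperBraceletFunction 𝓑 χ) (hD : G.IsCycle D) (hF : G.IsCycle F) (hD𝓑 : D ∉ 𝓑)
    (hF𝓑 : F ∉ 𝓑) (hDF : Disjoint (G.vertsOf D) (G.vertsOf F))
    (h3 : G.cyclomaticNumber (C ∪ D ∪ F) = 3) (h : G.BraceletDep 𝓑 χ C F) :
    G.BraceletDep 𝓑 χ D F := by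
  obtain ⟨hB, h⟩ := h
  have hB' : G.IsBracelet 𝓑 (D ∪ F) := ⟨D, F, hD, hF, hD𝓑, hF𝓑, hDF, rfl⟩
  refine ⟨hB', ?_⟩
  rw [← h]
  -- Adjacency requires distinct bracelets, so equal unions are treated separately.
  by_cases heq : D ∪ F = C ∪ F
  · congr 1
    exact Subtype.ext heq
  · refine (hχ _ _ (SimpleGraph.Adj.reachable ⟨fun h => heq (congrArg Subtype.val h).symm, ?_⟩)).symm
    have : C ∪ F ∪ (D ∪ F) = C ∪ D ∪ F := by
      ext; simp only [mem_union]; tauto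
    rw [← h3, ← this]

/-- Move `C` towards `D` while staying disjoint from `F`. If they share at most one vertex, the two
bracelets are equal or adjacent. Otherwise a path `P` of `D` outside `C` splits `C` into `Q` and
`R`, and one of `P ∪ Q`, `P ∪ R` is unbalanced because `C` is. That cycle gives with `F` a bracelet
equal or adjacent to `C ∪ F`, and has a smaller union with `D`. -/
lemma BraceletDep.congr {χ : G.Bracelet 𝓑 → BraceletValue} (h𝓑 : G.IsBiased 𝓑)
    (hχ : G.IsProperBraceletFunction 𝓑 χ) (hC : G.IsCycle C) (hD : G.IsCycle D)
    (hF : G.IsCycle F) (hC𝓑 : C ∉ 𝓑) (hD𝓑 : D ∉ 𝓑) (hF𝓑 : F ∉ 𝓑)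
    (hCF : Disjoint (G.vertsOf C) (G.vertsOf F)) (hDF : Disjoint (G.vertsOf D) (G.vertsOf F))
    (h : G.BraceletDep 𝓑 χ C F) : G.BraceletDep 𝓑 χ D F := by
  induction hn : (C ∪ D).ncard using Nat.strong_induction_on generalizing C with
  | _ n ih =>
  subst hn
  rcases eq_or_ne C D with rfl | hne
  · exact h
  by_cases hs : (G.vertsOf C ∩ G.vertsOf D).Subsingleton
  · exact h.of_cyclomaticNumber hχ hD hF hD𝓑 hF𝓑 hDF
      (cyclomaticNumber_eq_three_of_isCycle hC hD hF hne hs hCF hDF)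
  obtain ⟨x, hx, y, hy, hxy⟩ := Set.not_subsingleton_iff.1 hs
  obtain ⟨P, Q, R, hT, hP, hQR⟩ := hD.exists_isTheta_of_isCycle hC hne.symm hx.symm hy.symm hxy
  have key : ∀ Q R, G.IsTheta P Q R → Q ∪ R = C → P ∪ Q ∉ 𝓑 → G.BraceletDep 𝓑 χ D F := by
    rintro Q R hT rfl hPQ
    have hRF : Disjoint (G.vertsOf R) (G.vertsOf F) :=
      hCF.mono_left (vertsOf_mono subset_union_right)
    have hPQF : Disjoint (G.vertsOf (P ∪ Q)) (G.vertsOf F) := by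
      rw [vertsOf_union]
      exact (hDF.mono_left (vertsOf_mono (hP.trans sdiff_subset))).union_left
        (hCF.mono_left (vertsOf_mono subset_union_left))
    have h' : G.BraceletDep 𝓑 χ (P ∪ Q) F := by
      refine h.of_cyclomaticNumber hχ hT.isCycle hF hPQ hF𝓑 hPQF ?_
      rw [← cyclomaticNumber_eq_three_of_isTheta hT hF hPQF hRF]
      congr 1
      ext; simp only [mem_union]; tauto
    -- The union with `D` fails to shrink only if `R` lies in `D`; then `D = P ∪ R` is itself a
    -- cycle of the theta and is reached in one step.
    by_cases hRD : R ⊆ D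
    · have hPRD := hD.eq_of_subset hT.swap_right.isCycle (union_subset (hP.trans sdiff_subset) hRD)
      refine h.of_cyclomaticNumber hχ hD hF hD𝓑 hF𝓑 hDF ?_
      rw [← cyclomaticNumber_eq_three_of_isTheta hT hF hPQF hRF, ← hPRD]
      congr 1
      ext; simp only [mem_union]; tauto
    · refine ih _ (ncard_lt_ncard ⟨?_, fun hsub => ?_⟩ (hC.finite.union hD.finite)) hT.isCycle hPQ
        hPQF h' rfl
      · rintro f ((hf | hf) | hf)
        · exact Or.inr (hP hf).1
        · exact Or.inl (Or.inl hf)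
        · exact Or.inr hf
      · obtain ⟨f, hfR, hfD⟩ := Set.not_subset.1 hRD
        rcases hsub (Or.inl (Or.inr hfR)) with (hf | hf) | hf
        · exact (hP hf).2 (Or.inr hfR)
        · exact Set.disjoint_left.1 hT.rotate.disjoint hf hfR
        · exact hfD hf
  by_cases hPQ : P ∪ Q ∈ 𝓑
  · refine key R Q hT.swap_right (by rw [union_comm, hQR]) fun hPR => hC𝓑 ?_
    exact hQR ▸ h𝓑.theta P Q R hT hPQ hPR
  · exact key Q R hT hQR hPQ

lemma isProperRel_braceletDep {χ : G.Bracelet 𝓑 → BraceletValue} (h𝓑 : G.IsBiased 𝓑)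
    (hχ : G.IsProperBraceletFunction 𝓑 χ) : G.IsProperRel 𝓑 (G.BraceletDep 𝓑 χ) where
  symm _ _ h := h.symm
  congr _ _ _ hC hD hF hC𝓑 hD𝓑 hF𝓑 hCF hDF h := h.congr h𝓑 hχ hC hD hF hC𝓑 hD𝓑 hF𝓑 hCF hDF

/-- `BraceletDep` depends only on the union `C ∪ D`, so the way a bracelet is written as two cycles
does not matter. -/
lemma braceletCircuits_eq (χ : G.Bracelet 𝓑 → BraceletValue) :
    G.braceletCircuits 𝓑 χ = G.pairCircuits 𝓑 (G.BraceletDep 𝓑 χ) := by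
  ext X
  refine or_congr Iff.rfl (or_congr Iff.rfl (or_congr Iff.rfl (or_congr ?_ ?_)))
  · constructor
    · rintro ⟨⟨_, hB⟩, hχ, rfl⟩
      obtain ⟨C, C', hC, hC', h1, h2, h3, rfl⟩ := id hB
      exact ⟨C, C', hC, hC', h3, h1, h2, ⟨hB, hχ⟩, rfl⟩
    · rintro ⟨C, C', -, -, -, -, -, ⟨hB, hχ⟩, rfl⟩
      exact ⟨⟨_, hB⟩, hχ, rfl⟩
  · constructor
    · rintro ⟨⟨_, hB⟩, C, C', P, hχ, hL, h1, h2, rfl, rfl⟩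
      refine ⟨C, C', P, hL, h1, h2, ?_, rfl⟩
      rintro ⟨_, hχ'⟩
      rw [hχ] at hχ'
      cases hχ'
    · rintro ⟨C, C', P, hL, h1, h2, h3, rfl⟩
      have hB : G.IsBracelet 𝓑 (C ∪ C') := ⟨C, C', hL.1, hL.2.1, h1, h2, hL.2.2.1, rfl⟩
      refine ⟨⟨_, hB⟩, C, C', P, ?_, hL, h1, h2, rfl, rfl⟩
      rcases hv : χ ⟨_, hB⟩ with _ | _
      · rfl
      · exact absurd ⟨hB, hv⟩ h3

/-! ### Tripartitions -/

namespace IsProperTripartition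

lemma isBiased (h : G.IsProperTripartition 𝓑 𝓛 𝓕) : G.IsBiased 𝓑 :=
  ⟨fun _ hC => h.union_eq.subset (Or.inl (Or.inl hC)), h.theta⟩

lemma isCycle_left (h : G.IsProperTripartition 𝓑 𝓛 𝓕) (hC : C ∈ 𝓛) : G.IsCycle C :=
  h.union_eq.subset (Or.inl (Or.inr hC))

lemma mem_or_mem (h : G.IsProperTripartition 𝓑 𝓛 𝓕) (hC : G.IsCycle C) (hC𝓑 : C ∉ 𝓑) :
    C ∈ 𝓛 ∨ C ∈ 𝓕 :=
  or_assoc.1 (h.union_eq.symm.subset hC) |>.resolve_left hC𝓑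

lemma mem_of_disjoint (h : G.IsProperTripartition 𝓑 𝓛 𝓕) (hC : C ∈ 𝓛) (hD : G.IsCycle D)
    (hD𝓑 : D ∉ 𝓑) (hCD : Disjoint (G.vertsOf C) (G.vertsOf D)) : D ∈ 𝓛 :=
  (h.mem_or_mem hD hD𝓑).resolve_right fun hD' =>
    (h.meets C hC D hD').ne_empty hCD.inter_eq

lemma isProperRel (h : G.IsProperTripartition 𝓑 𝓛 𝓕) :
    G.IsProperRel 𝓑 fun C D => C ∈ 𝓛 ∧ D ∈ 𝓛 where
  symm _ _ hCD := ⟨hCD.2, hCD.1⟩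
  congr _ _ _ _ hD _ _ hD𝓑 _ _ hDF hCF := ⟨h.mem_of_disjoint hCF.2 hD hD𝓑 hDF.symm, hCF.2⟩

lemma tripartitionCircuits_eq (h : G.IsProperTripartition 𝓑 𝓛 𝓕) :
    G.tripartitionCircuits 𝓑 𝓛 𝓕 = G.pairCircuits 𝓑 fun C D => C ∈ 𝓛 ∧ D ∈ 𝓛 := by
  ext X
  refine or_congr Iff.rfl (or_congr Iff.rfl (or_congr Iff.rfl (or_congr ?_ ?_)))
  · constructor
    · rintro ⟨C, C', hC, hC', hd, rfl⟩
      exact ⟨C, C', h.isCycle_left hC, h.isCycle_left hC', hd,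
        Set.disjoint_right.1 h.disjoint_BL hC, Set.disjoint_right.1 h.disjoint_BL hC',
        ⟨hC, hC'⟩, rfl⟩
    · rintro ⟨C, C', -, -, hd, -, -, ⟨hC, hC'⟩, rfl⟩
      exact ⟨C, C', hC, hC', hd, rfl⟩
  · constructor
    · rintro ⟨C, C', P, hL, hC, hC', rfl⟩
      exact ⟨C, C', P, hL, Set.disjoint_right.1 h.disjoint_BF hC,
        Set.disjoint_right.1 h.disjoint_BF hC',
        fun hh => Set.disjoint_right.1 h.disjoint_LF hC hh.1, rfl⟩
    · rintro ⟨C, C', P, hL, hC𝓑, hC'𝓑, hn, rfl⟩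
      -- A disjoint unbalanced pair with one member in `𝓛` has both in `𝓛`; hence a pair that is not
      -- dependent lies entirely in `𝓕`.
      refine ⟨C, C', P, hL, (h.mem_or_mem hL.1 hC𝓑).resolve_left fun hC => hn ⟨hC, ?_⟩,
        (h.mem_or_mem hL.2.1 hC'𝓑).resolve_left fun hC' => hn ⟨?_, hC'⟩, rfl⟩
      · exact h.mem_of_disjoint hC hL.2.1 hC'𝓑 hL.2.2.1
      · exact h.mem_of_disjoint hC' hL.1 hC𝓑 hL.2.2.1.symm

end IsProperTripartition

end Graph

/-! ### Both parts as instances of the matroid of a proper relation -/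

theorem mainTheorem2 {V E : Type*} (G : Graph V E) :
    (∀ (𝓑 : Set (Set E)) (χ : G.Bracelet 𝓑 → Graph.BraceletValue),
      G.IsBiased 𝓑 → G.IsProperBraceletFunction 𝓑 χ →
        G.IsCircuitSetOfMatroid (G.braceletCircuits 𝓑 χ)) ∧
    (∀ 𝓑 𝓛 𝓕 : Set (Set E), G.IsProperTripartition 𝓑 𝓛 𝓕 →
        G.IsCircuitSetOfMatroid (G.tripartitionCircuits 𝓑 𝓛 𝓕)) := by
  constructor
  · intro 𝓑 χ h𝓑 hχ
    rw [Graph.braceletCircuits_eq]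
    exact Graph.isCircuitSetOfMatroid_pairCircuits h𝓑 (Graph.isProperRel_braceletDep h𝓑 hχ)
  · intro 𝓑 𝓛 𝓕 h
    rw [h.tripartitionCircuits_eq]
    exact Graph.isCircuitSetOfMatroid_pairCircuits h.isBiased h.isProperRel
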